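/- A $k$-CNF formula is a conjunction of clauses, each a disjunction of at most $k$ literals; $|\phi|$ denotes the length of the encoding of $\phi$ over a fixed finite alphabet, with variable names written in binary. The primal graph of a CNF formula $\phi$ has the variables of $\phi$ as vertices, two distinct variables being adjacent when they appear in a common clause. A graph has tree-depth at most $c$ if its vertices can be arranged bijectively as a rooted forest in which every path to a root has at most $c$ vertices, such that the two ends of every edge of the graph are in an ancestor–descendant relation. A modulator of $\phi$ to tree-depth at most $c$ is a set $M$ of variables of $\phi$ such that deleting the vertices in $M$ from the primal graph of $\phi$ leaves a graph of tree-depth at most $c$. Algorithms are deterministic multi-tape (multi-stack) Turing machines. The Strong Exponential Time Hypothesis (SETH) states that for every real $\varepsilon>0$ there is a $k$ such that no algorithm decides, given a $k$-CNF formula $\phi$ with $n$ variables, whether $\phi$ is satisfiable in time $(2-\varepsilon)^n|\phi|^{O(1)}$. **Theorem.** The following statements are equivalent. 1. The SETH is false: there is an $\varepsilon>0$ such that for all $k$ there is an algorithm that decides the satisfiability of $k$-CNF formulas $\phi$ with $n$ variables in time $(2-\varepsilon)^n|\phi|^{O(1)}$. 2. There is an $\varepsilon>0$ such that for all $c,k$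 there is an algorithm that takes as input a $k$-CNF formula $\phi$ and a modulator $M$ of $\phi$ to tree-depth at most $c$, and decides whether $\phi$ is satisfiable in time $(2-\varepsilon)^{|M|}|\phi|^{O(1)}$. Here the algorithm and the constants hidden in $O(1)$ and in the running time may depend on $\varepsilon$ and $k$ (and, in 2, on $c$), and $\varepsilon$ in 1 and in 2 need not be the same. -/

import Mathlib

/-! ### CNF formulas -/

/-- A literal over variables named by natural numbers: `(v, true)` is the variable `v` and
`(v, false)` is its negation. -/
abbrev Literal : Type := ℕ × Bool

/-- A clause is a written-out disjunction of literals; its arity is the length of the list. -/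
abbrev Clause : Type := List Literal

/-- A CNF formula is a written-out conjunction of clauses (repeated clauses are allowed). -/
abbrev CNF : Type := List Clause

namespace CNF

/-- All clauses have arity at most `k`. -/
def IsKCNF (k : ℕ) (φ : CNF) : Prop := ∀ C ∈ φ, C.length ≤ k

/-- The set of variables that occur in `φ`. -/
def vars (φ : CNF) : Finset ℕ := (φ.flatten.map Prod.fst).toFinset

/-- The formula has a satisfying assignment: one that makes some literal of every clause true. -/
def Satisfiable (φ : CNF) : Prop := ∃ σ : ℕ → Bool, ∀ C ∈ φ, ∃ l ∈ C, σ l.1 = l.2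

/-- The primal graph: its vertices are the variables of `φ`, and two different variables are
adjacent when they appear in the same clause. -/
def primalGraph (φ : CNF) : SimpleGraph {v // v ∈ φ.vars} where
  Adj u v := u ≠ v ∧ ∃ C ∈ φ, (∃ l ∈ C, l.1 = u.1) ∧ (∃ l ∈ C, l.1 = v.1)
  symm := ⟨fun _ _ ⟨hne, C, hC, hu, hv⟩ => ⟨hne.symm, C, hC, hv, hu⟩⟩
  loopless := ⟨fun _ h => h.1 rfl⟩

/-- The primal graph of `φ` after the variables in the list `M` have been removed. -/
def primalGraphSub (φ : CNF) (M : List ℕ) :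
    SimpleGraph {v : {v // v ∈ φ.vars} | v.1 ∉ M} :=
  φ.primalGraph.induce {v | v.1 ∉ M}

end CNF

/-! ### Tree-depth -/

/-- The vertex reached from `v` after following `i` times the partial map `parent`. -/
def nthAncestor {V : Type} (parent : V → Option V) : ℕ → V → Option V
  | 0, v => some v
  | i + 1, v => (nthAncestor parent i v).bind parent

/-- `G` has tree-depth at most `c`: the vertices of `G` can be arranged as a rooted forest (given
by its parent map, undefined at the roots) in which every path to a root has at most `c` vertices,
so that the two ends of every edge of `G` are in an ancestor-descendant relation. -/
def HasTreeDepthAtMost {V : Type} (G : SimpleGraph V) (c : ℕ) : Prop :=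
  ∃ parent : V → Option V,
    (∀ v, nthAncestor parent c v = none) ∧
    ∀ u v, G.Adj u v →
      (∃ i, nthAncestor parent i u = some v) ∨ (∃ i, nthAncestor parent i v = some u)

/-! ### Encoding of the inputs -/

/-- The finite alphabet in which inputs are written. -/
inductive InSym where
  | bit (b : Bool)
  | pos
  | neg
  | endClause
  | endFormula
  | modVar
  deriving DecidableEq, Fintype

/-- The name of a variable is written in binary (least significant bit first). -/
def encodeVar (v : ℕ) : List InSym := v.bits.map InSym.bit

/-- A literal is written as its sign followed by its variable. -/
def encodeLiteral (l : Literal) : List InSym :=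
  (if l.2 then InSym.pos else InSym.neg) :: encodeVar l.1

/-- A clause is written as the sequence of its literals and an end marker. -/
def encodeClause (C : Clause) : List InSym := C.flatMap encodeLiteral ++ [InSym.endClause]

/-- A formula is written as the sequence of its clauses and an end marker. -/
def encodeCNF (φ : CNF) : List InSym := φ.flatMap encodeClause ++ [InSym.endFormula]

/-- A formula together with a list of variables. -/
def encodeCNFWithSet (x : CNF × List ℕ) : List InSym :=
  encodeCNF x.1 ++ x.2.flatMap (fun v => InSym.modVar :: encodeVar v)

/-- `|φ|`: the number of symbols needed to write `φ`. -/
def CNF.size (φ : CNF) : ℕ := (encodeCNF φ).length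

/-! ### Algorithms and their running time -/

open Classical in
/-- There is an algorithm (a Turing machine with finitely many stacks) which, on every instance
`x` satisfying `valid`, written as `enc x`, halts after at most `T x` steps with the correct
one-bit answer to the question whether `yes x` holds. -/
def SolvableInTime {I : Type} (valid : I → Prop) (enc : I → List InSym) (yes : I → Prop)
    (T : I → ℝ) : Prop :=
  ∃ A : Turing.TM2ComputableAux InSym Bool, ∀ x, valid x →
    ∃ t : ℕ, (t : ℝ) ≤ T x ∧
      Nonempty (Turing.TM2OutputsInTime A.tm ((enc x).map A.inputAlphabet.invFun)
        (some ((Computability.encodeBool (decide (yes x))).map A.outputAlphabet.invFun)) t)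

/-- For some constant `a`, there is an algorithm that decides the satisfiability of a given
`k`-CNF formula `φ` with `n` variables in time at most `a * (2 - ε) ^ n * |φ| ^ a`. -/
def KSatSolvable (ε : ℝ) (k : ℕ) : Prop :=
  ∃ a : ℕ, SolvableInTime (fun φ : CNF => φ.IsKCNF k) encodeCNF CNF.Satisfiable
    (fun φ => a * (2 - ε) ^ φ.vars.card * (φ.size : ℝ) ^ a)

/-- The Strong Exponential Time Hypothesis. -/
def SETH : Prop := ∀ ε : ℝ, 0 < ε → ∃ k : ℕ, ¬ KSatSolvable ε k

/-- `(φ, M)` consists of a `k`-CNF formula `φ` and a list, in any order and without repetitions,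
of the elements of a set `M` of variables of `φ` whose removal from the primal graph leaves a graph
of tree-depth at most `c`. -/
def IsModulatorInstance (c k : ℕ) (x : CNF × List ℕ) : Prop :=
  x.1.IsKCNF k ∧ x.2.Nodup ∧ (∀ v ∈ x.2, v ∈ x.1.vars) ∧
    HasTreeDepthAtMost (x.1.primalGraphSub x.2) c

/-- For some constant `a`, there is an algorithm that, given a `k`-CNF formula `φ` and a modulator
`M` of `φ` to tree-depth at most `c`, decides the satisfiability of `φ` in time at most
`a * (2 - ε) ^ |M| * |φ| ^ a`. -/
def KSatModulatorSolvable (ε : ℝ) (c k : ℕ) : Prop :=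
  ∃ a : ℕ, SolvableInTime (IsModulatorInstance c k) encodeCNFWithSet (fun x => x.1.Satisfiable)
    (fun x => a * (2 - ε) ^ x.2.length * (x.1.size : ℝ) ^ a)

/-! From 2 to 1, take `M` to be all variables: nothing is left of the primal graph, so tree-depth 0
is enough, and a polynomial-time program only has to list the variables.

From 1 to 2, eliminate the variables outside `M` by resolution, layer by layer. In the primal graph
without `M`, the variables of a clause form a clique, so they are pairwise comparable in the forest
and lie on one root path. Hence a clause contains at most one variable of the deepest layer, and the
whole layer can be eliminated in a single Davis–Putnam round that resolves every pair of clauses on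
every literal (`Layering.extend`). The resolvents needed are again supported on root paths, because
the ancestors of the eliminated variable form a chain. Superfluous resolvents are harmless, since
all of them are implied (`CNF.satisfies_resolve`). After `c` rounds the clauses over `M` alone are
equisatisfiable with the original formula (`satisfiable_restrict_iff`).

A round at most doubles the arity and increases the length polynomially. For fixed `c` the result is
therefore a `2 ^ c * k`-CNF of polynomial size with at most `|M|` variables. Failure of SETH gives
one `ε` for all arities, so the growth of the arity costs nothing in the base of the exponential.

The rest is the implementation: a small calculus of stack programs with time bounds, programs for
resolution, filtering and listing variables, and the composition of such a program with a given
decision machine (`outputs_precompose`). Replacing `ε` by `min ε 1` makes the base at least 1, so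
that the exponential factor absorbs the polynomial overhead. -/

open Turing

/-! ### Counting the steps of a partial transition function -/

/-- `StepsIn f n a b`: iterating the partial map `f` exactly `n` times leads from `a` to `b`. -/
inductive StepsIn {C : Type} (f : C → Option C) : ℕ → C → C → Prop
  | refl (a : C) : StepsIn f 0 a a
  | head {n : ℕ} {a b c : C} : f a = some b → StepsIn f n b c → StepsIn f (n + 1) a c

namespace StepsIn

variable {C D : Type} {f : C → Option C} {g : D → Option D} {m n : ℕ} {a b c : C}

theorem trans (h₁ : StepsIn f m a b) (h₂ : StepsIn f n b c) : StepsIn f (m + n) a c := by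
  induction h₁ with
  | refl => simpa using h₂
  | head h _ ih =>
    rw [Nat.add_right_comm]
    exact .head h (ih h₂)

theorem single (h : f a = some b) : StepsIn f 1 a b := .head h (.refl b)

/-- The simulation principle behind every program construction: a map of configurations that
respects single steps preserves runs together with their exact lengths. -/
theorem map (φ : C → D) (hφ : ∀ a b, f a = some b → g (φ a) = some (φ b))
    (h : StepsIn f n a b) : StepsIn g n (φ a) (φ b) := by
  induction h with
  | refl => exact .refl _
  | head h _ ih => exact .head (hφ _ _ h) ih

/-- `TM2OutputsInTime` is phrased by iterating `flip bind f` on `Option`. Since `none` is a fixed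
point of the iteration, reaching `some b` means that no step before was undefined. -/
theorem iff_iterate : StepsIn f n a b ↔ (flip bind f)^[n] (some a) = some b := by
  induction n generalizing a with
  | zero =>
    constructor
    · rintro ⟨⟩; rfl
    · intro h
      cases h
      exact .refl _
  | succ n ih =>
    rw [Function.iterate_succ_apply]
    constructor
    · rintro (_ | ⟨h, h'⟩)
      rw [show flip bind f (some a) = f a from rfl, h]
      exact ih.1 h'
    · intro h
      rw [show flip bind f (some a) = f a from rfl] at h
      cases hfa : f a with
      | none =>
        rw [hfa] at h
        exfalso
        have hn : ∀ k, (flip bind f)^[k] (none : Option C) = none := by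
          intro k
          induction k with
          | zero => rfl
          | succ k ihk => rw [Function.iterate_succ_apply]; exact ihk
        rw [hn] at h
        cases h
      | some b' =>
        rw [hfa] at h
        exact .head hfa (ih.2 h)

end StepsIn

/-! ### Programs for stack machines -/

/-- The contents of the stacks of a machine. -/
abbrev Store (K : Type) : Type := K → List InSym

/-- The finite memory of a program, used only within a single step. -/
abbrev Buffer : Type := Option InSym × Option InSym

/-- Statements of programs. -/
abbrev ProgStmt (K Λ : Type) : Type := TM2.Stmt (fun _ : K => InSym) Λ Buffer

/-- A program for a machine with stacks `K`, all of them over the input alphabet. -/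
structure Prog (K : Type) where
  /-- the labels -/
  Λ : Type
  [fin : Fintype Λ]
  /-- the first label -/
  main : Λ
  /-- the code -/
  m : Λ → ProgStmt K Λ

attribute [instance] Prog.fin

/-- Rename the labels of a statement, and jump to `e` instead of halting. -/
def relabel {K Λ Λ' : Type} (f : Λ → Λ') (e : Λ') : ProgStmt K Λ → ProgStmt K Λ'
  | .push k g q => .push k g (relabel f e q)
  | .peek k g q => .peek k g (relabel f e q)
  | .pop k g q => .pop k g (relabel f e q)
  | .load g q => .load g (relabel f e q)
  | .branch g q r => .branch g (relabel f e q) (relabel f e r)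
  | .goto g => .goto (fun v => f (g v))
  | .halt => .goto (fun _ => e)

/-- Rename the labels of a statement. -/
def rename {K Λ Λ' : Type} (f : Λ → Λ') : ProgStmt K Λ → ProgStmt K Λ'
  | .push k g q => .push k g (rename f q)
  | .peek k g q => .peek k g (rename f q)
  | .pop k g q => .pop k g (rename f q)
  | .load g q => .load g (rename f q)
  | .branch g q r => .branch g (rename f q) (rename f r)
  | .goto g => .goto (fun v => f (g v))
  | .halt => .halt

section

variable {K Λ Λ' : Type} [DecidableEq K]

theorem stepAux_relabel (f : Λ → Λ') (e : Λ') (q : ProgStmt K Λ) (v : Buffer) (S : Store K) :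
    TM2.stepAux (relabel f e q) v S =
      ⟨some ((TM2.stepAux q v S).l.elim e f), (TM2.stepAux q v S).var,
        (TM2.stepAux q v S).stk⟩ := by
  induction q generalizing v S with
  | branch g q r ihq ihr =>
    simp only [relabel, TM2.stepAux]
    cases g v
    · exact ihr v S
    · exact ihq v S
  | push k g q ih => simp only [relabel, TM2.stepAux]; exact ih _ _
  | peek k g q ih => simp only [relabel, TM2.stepAux]; exact ih _ _
  | pop k g q ih => simp only [relabel, TM2.stepAux]; exact ih _ _
  | load g q ih => simp only [relabel, TM2.stepAux]; exact ih _ _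
  | goto g => simp [relabel, TM2.stepAux]
  | halt => simp [relabel, TM2.stepAux]

theorem stepAux_rename (f : Λ → Λ') (q : ProgStmt K Λ) (v : Buffer) (S : Store K) :
    TM2.stepAux (rename f q) v S =
      ⟨(TM2.stepAux q v S).l.map f, (TM2.stepAux q v S).var, (TM2.stepAux q v S).stk⟩ := by
  induction q generalizing v S with
  | branch g q r ihq ihr =>
    simp only [rename, TM2.stepAux]
    cases g v
    · exact ihr v S
    · exact ihq v S
  | push k g q ih => simp only [rename, TM2.stepAux]; exact ih _ _
  | peek k g q ih => simp only [rename, TM2.stepAux]; exact ih _ _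
  | pop k g q ih => simp only [rename, TM2.stepAux]; exact ih _ _
  | load g q ih => simp only [rename, TM2.stepAux]; exact ih _ _
  | goto g => simp [rename, TM2.stepAux]
  | halt => simp [rename, TM2.stepAux]

/-- Halting happens at the end of a step, so replacing it by a jump to `e` takes no extra time: the
label `none` is simply mapped to `e`. -/
theorem StepsIn.relabel {m : Λ → ProgStmt K Λ} {m' : Λ' → ProgStmt K Λ'} (f : Λ → Λ') (e : Λ')
    (hm : ∀ l, m' (f l) = relabel f e (m l)) {n : ℕ} {l : Option Λ} {v v' : Buffer}
    {S S' : Store K}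
    (h : StepsIn (TM2.step m) n ⟨l, v, S⟩ ⟨none, v', S'⟩) :
    StepsIn (TM2.step m') n ⟨some (l.elim e f), v, S⟩ ⟨some e, v', S'⟩ := by
  refine StepsIn.map (g := TM2.step m') (fun c : TM2.Cfg (fun _ : K => InSym) Λ Buffer =>
    (⟨some (c.l.elim e f), c.var, c.stk⟩ : TM2.Cfg (fun _ : K => InSym) Λ' Buffer)) ?_ h
  rintro ⟨_ | l, v, S⟩ b hb
  · simp [TM2.step] at hb
  · simp only [TM2.step, Option.some.injEq] at hb
    subst hb
    simp [TM2.step, hm, stepAux_relabel]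

theorem StepsIn.rename {m : Λ → ProgStmt K Λ} {m' : Λ' → ProgStmt K Λ'} (f : Λ → Λ')
    (hm : ∀ l, m' (f l) = rename f (m l)) {n : ℕ} {l : Option Λ} {v v' : Buffer}
    {S S' : Store K}
    (h : StepsIn (TM2.step m) n ⟨l, v, S⟩ ⟨none, v', S'⟩) :
    StepsIn (TM2.step m') n ⟨l.map f, v, S⟩ ⟨none, v', S'⟩ := by
  refine StepsIn.map (g := TM2.step m') (fun c : TM2.Cfg (fun _ : K => InSym) Λ Buffer =>
    (⟨c.l.map f, c.var, c.stk⟩ : TM2.Cfg (fun _ : K => InSym) Λ' Buffer)) ?_ h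
  rintro ⟨_ | l, v, S⟩ b hb
  · simp [TM2.step] at hb
  · simp only [TM2.step, Option.some.injEq] at hb
    subst hb
    simp [TM2.step, hm, stepAux_rename]

end

namespace Prog

variable {K : Type}

/-- The program that executes a single statement. -/
def atom (q : ProgStmt K Unit) : Prog K := ⟨Unit, (), fun _ => q⟩

/-- Do nothing. -/
def skip : Prog K := atom .halt

/-- Push the symbol `a` on the stack `k`. -/
def push (k : K) (a : InSym) : Prog K := atom (.push k (fun _ => a) .halt)

/-- Remove the top of the stack `k`. -/
def pop (k : K) : Prog K := atom (.pop k (fun v _ => v) .halt)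

/-- Push the image under `f` of the top of the stack `X` on the stack `Y`. -/
def dup (X Y : K) (f : InSym → InSym) : Prog K :=
  atom (.peek X (fun v o => (o, v.2)) (.push Y (fun v => f (v.1.getD .pos))
    (.load (fun _ => (none, none)) .halt)))

/-- Run one program after another. -/
def seq (p q : Prog K) : Prog K where
  Λ := p.Λ ⊕ q.Λ
  main := .inl p.main
  m
    | .inl l => relabel .inl (.inr q.main) (p.m l)
    | .inr l => rename .inr (q.m l)

/-- Choose a program according to a test on the tops of two stacks. -/
def ite (X Y : K) (c : Option InSym → Option InSym → Bool) (p q : Prog K) : Prog K where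
  Λ := Option (p.Λ ⊕ q.Λ)
  main := none
  m
    | none => .peek X (fun v o => (o, v.2)) (.peek Y (fun v o => (v.1, o))
        (.branch (fun v => c v.1 v.2)
          (.load (fun _ => (none, none)) (.goto fun _ => some (.inl p.main)))
          (.load (fun _ => (none, none)) (.goto fun _ => some (.inr q.main)))))
    | some (.inl l) => rename (fun l => some (.inl l)) (p.m l)
    | some (.inr l) => rename (fun l => some (.inr l)) (q.m l)

/-- Repeat a program as long as a test on the tops of two stacks succeeds. -/
def loop (X Y : K) (c : Option InSym → Option InSym → Bool) (p : Prog K) : Prog K where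
  Λ := Option p.Λ
  main := none
  m
    | none => .peek X (fun v o => (o, v.2)) (.peek Y (fun v o => (v.1, o))
        (.branch (fun v => c v.1 v.2)
          (.load (fun _ => (none, none)) (.goto fun _ => some p.main))
          (.load (fun _ => (none, none)) .halt)))
    | some l => relabel some none (p.m l)

variable [DecidableEq K]

/-- Started on the stacks `s`, the program halts with the stacks `s'` after at most `t` steps. -/
def Run (p : Prog K) (s s' : Store K) (t : ℕ) : Prop :=
  ∃ n ≤ t, StepsIn (TM2.step p.m) n ⟨some p.main, (none, none), s⟩ ⟨none, (none, none), s'⟩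

variable {p q : Prog K} {s s₁ s₂ : Store K} {t t₁ t₂ : ℕ} {X Y : K}
  {c : Option InSym → Option InSym → Bool}

theorem Run.mono (h : p.Run s s₁ t₁) (ht : t₁ ≤ t₂) : p.Run s s₁ t₂ := by
  obtain ⟨n, hn, h⟩ := h
  exact ⟨n, hn.trans ht, h⟩

theorem Run.congr (h : p.Run s s₁ t₁) (hs : s₁ = s₂) (ht : t₁ ≤ t₂) : p.Run s s₂ t₂ :=
  hs ▸ h.mono ht

theorem run_skip : (skip : Prog K).Run s s 1 := ⟨1, le_rfl, .single rfl⟩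

theorem run_push (k : K) (a : InSym) :
    (push k a).Run s (Function.update s k (a :: s k)) 1 := ⟨1, le_rfl, .single rfl⟩

theorem run_pop (k : K) : (pop k).Run s (Function.update s k (s k).tail) 1 :=
  ⟨1, le_rfl, .single rfl⟩

/-- As `X` is nonempty, the default symbol in `dup` is never pushed. -/
theorem run_dup (f : InSym → InSym) {a : InSym} {r : List InSym} (h : s X = a :: r) :
    (dup X Y f).Run s (Function.update s Y (f a :: s Y)) 1 :=
  ⟨1, le_rfl, .single (by simp [TM2.step, dup, atom, h])⟩

/-- Runs start and end with the buffer `(none, none)`, so they fit together, and the halt of `p`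
becomes the jump to `q`; the times just add up. -/
theorem Run.seq (hp : p.Run s s₁ t₁) (hq : q.Run s₁ s₂ t₂) :
    (p.seq q).Run s s₂ (t₁ + t₂) := by
  obtain ⟨m, hm, hp⟩ := hp
  obtain ⟨n, hn, hq⟩ := hq
  refine ⟨m + n, Nat.add_le_add hm hn, ?_⟩
  exact (hp.relabel (m' := (p.seq q).m) .inl (.inr q.main) (fun _ => rfl)).trans
    (hq.rename (m' := (p.seq q).m) .inr (fun _ => rfl))

theorem Run.ite_true (hc : c (s X).head? (s Y).head? = true) (hp : p.Run s s₁ t) :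
    (ite X Y c p q).Run s s₁ (t + 1) := by
  obtain ⟨n, hn, hp⟩ := hp
  refine ⟨n + 1, Nat.add_le_add_right hn 1, .head ?_
    (hp.rename (m' := (ite X Y c p q).m) (fun l => some (.inl l)) (fun _ => rfl))⟩
  simp [TM2.step, ite, hc]

theorem Run.ite_false (hc : c (s X).head? (s Y).head? = false) (hq : q.Run s s₁ t) :
    (ite X Y c p q).Run s s₁ (t + 1) := by
  obtain ⟨n, hn, hq⟩ := hq
  refine ⟨n + 1, Nat.add_le_add_right hn 1, .head ?_
    (hq.rename (m' := (ite X Y c p q).m) (fun l => some (.inr l)) (fun _ => rfl))⟩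
  simp [TM2.step, ite, hc]

theorem Run.loop_true (hc : c (s X).head? (s Y).head? = true) (hp : p.Run s s₁ t₁)
    (hl : (loop X Y c p).Run s₁ s₂ t₂) : (loop X Y c p).Run s s₂ (t₁ + 1 + t₂) := by
  obtain ⟨m, hm, hp⟩ := hp
  obtain ⟨n, hn, hl⟩ := hl
  refine ⟨m + 1 + n, by omega, StepsIn.trans (.head ?_
    (hp.relabel (m' := (loop X Y c p).m) some none (fun _ => rfl))) hl⟩
  simp [TM2.step, loop, hc]

theorem run_loop_false (hc : c (s X).head? (s Y).head? = false) : (loop X Y c p).Run s s 1 :=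
  ⟨1, le_rfl, .single (by simp [TM2.step, loop, hc])⟩

/-- A loop that works through a list of items. -/
theorem run_loop_items {ι β : Type} (st : List ι → β → Store K) (f : β → ι → β)
    (I : List ι → β → Prop) (hI : ∀ i is b, I (i :: is) b → I is (f b i)) (B : ℕ)
    (hcons : ∀ i is b, I (i :: is) b →
      c (st (i :: is) b X).head? (st (i :: is) b Y).head? = true)
    (hnil : ∀ b, c (st [] b X).head? (st [] b Y).head? = false)
    (hbody : ∀ i is b, I (i :: is) b → p.Run (st (i :: is) b) (st is (f b i)) B)
    (items : List ι) (b : β) (h : I items b) :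
    (loop X Y c p).Run (st items b) (st [] (items.foldl f b)) (items.length * (B + 1) + 1) := by
  induction items generalizing b with
  | nil => exact (run_loop_false (hnil b)).mono (by simp)
  | cons i is ih =>
    -- Each round costs one step for the test and `B` for the body; the final `+ 1` is the test that
    -- fails.
    refine (Run.loop_true (hcons i is b h) (hbody i is b h) (ih (f b i) (hI i is b h))).mono ?_
    simp only [List.length_cons]
    ring_nf
    omega

/-- Symbols pushed while the items are read from left to right pile up in reverse order. This is why
results on `out` appear reversed until they are moved to another stack. -/
theorem foldl_emit {ι : Type} (g : ι → List InSym) (items : List ι) (o : List InSym) :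
    items.foldl (fun o i => (g i).reverse ++ o) o = (items.flatMap g).reverse ++ o := by
  induction items generalizing o with
  | nil => rfl
  | cons i is ih => simp [ih]

end Prog

/-! ### Running a program before a machine -/

section Embedding

variable {K₁ K₂ : Type} {Γ₁ : K₁ → Type} {Γ₂ : K₂ → Type} {Λ Λ' σ₁ σ₂ : Type}

/-- The alphabets of two machines side by side. -/
@[reducible]
def sumAlphabet (Γ₁ : K₁ → Type) (Γ₂ : K₂ → Type) : K₁ ⊕ K₂ → Type
  | .inl k => Γ₁ k
  | .inr k => Γ₂ k

/-- Execute a statement on the left stacks of a larger machine, jumping to `e` at the end. -/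
def embedLeft (Γ₂ : K₂ → Type) (σ₂ : Type) (f : Λ → Λ') (e : Λ') :
    TM2.Stmt Γ₁ Λ σ₁ → TM2.Stmt (sumAlphabet Γ₁ Γ₂) Λ' (σ₁ × σ₂)
  | .push k g q => .push (.inl k) (fun v => g v.1) (embedLeft Γ₂ σ₂ f e q)
  | .peek k g q => .peek (.inl k) (fun v o => (g v.1 o, v.2)) (embedLeft Γ₂ σ₂ f e q)
  | .pop k g q => .pop (.inl k) (fun v o => (g v.1 o, v.2)) (embedLeft Γ₂ σ₂ f e q)
  | .load g q => .load (fun v => (g v.1, v.2)) (embedLeft Γ₂ σ₂ f e q)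
  | .branch g q r => .branch (fun v => g v.1) (embedLeft Γ₂ σ₂ f e q) (embedLeft Γ₂ σ₂ f e r)
  | .goto g => .goto (fun v => f (g v.1))
  | .halt => .goto (fun _ => e)

/-- Execute a statement on the right stacks of a larger machine. -/
def embedRight (Γ₁ : K₁ → Type) (σ₁ : Type) (f : Λ → Λ') :
    TM2.Stmt Γ₂ Λ σ₂ → TM2.Stmt (sumAlphabet Γ₁ Γ₂) Λ' (σ₁ × σ₂)
  | .push k g q => .push (.inr k) (fun v => g v.2) (embedRight Γ₁ σ₁ f q)
  | .peek k g q => .peek (.inr k) (fun v o => (v.1, g v.2 o)) (embedRight Γ₁ σ₁ f q)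
  | .pop k g q => .pop (.inr k) (fun v o => (v.1, g v.2 o)) (embedRight Γ₁ σ₁ f q)
  | .load g q => .load (fun v => (v.1, g v.2)) (embedRight Γ₁ σ₁ f q)
  | .branch g q r => .branch (fun v => g v.2) (embedRight Γ₁ σ₁ f q) (embedRight Γ₁ σ₁ f r)
  | .goto g => .goto (fun v => f (g v.2))
  | .halt => .halt

/-- The stacks of two machines side by side. -/
def sumStk (S : ∀ k, List (Γ₁ k)) (T : ∀ k, List (Γ₂ k)) :
    ∀ k : K₁ ⊕ K₂, List (sumAlphabet Γ₁ Γ₂ k)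
  | .inl k => S k
  | .inr k => T k

variable [DecidableEq K₁] [DecidableEq K₂]

theorem update_sumStk_inl (S : ∀ k, List (Γ₁ k)) (T : ∀ k, List (Γ₂ k)) (k : K₁)
    (l : List (Γ₁ k)) :
    Function.update (sumStk S T) (.inl k) l = sumStk (Function.update S k l) T := by
  funext j
  rcases j with j | j
  · by_cases h : j = k
    · subst h
      simp [sumStk]
    · have h' : (Sum.inl j : K₁ ⊕ K₂) ≠ .inl k := fun e => h (Sum.inl.inj e)
      rw [Function.update_of_ne h']
      simp [sumStk, Function.update_of_ne h]
  · rw [Function.update_of_ne (by simp)]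
    rfl

theorem update_sumStk_inr (S : ∀ k, List (Γ₁ k)) (T : ∀ k, List (Γ₂ k)) (k : K₂)
    (l : List (Γ₂ k)) :
    Function.update (sumStk S T) (.inr k) l = sumStk S (Function.update T k l) := by
  funext j
  rcases j with j | j
  · rw [Function.update_of_ne (by simp)]
    rfl
  · by_cases h : j = k
    · subst h
      simp [sumStk]
    · have h' : (Sum.inr j : K₁ ⊕ K₂) ≠ .inr k := fun e => h (Sum.inr.inj e)
      rw [Function.update_of_ne h']
      simp [sumStk, Function.update_of_ne h]

theorem stepAux_embedLeft (f : Λ → Λ') (e : Λ') (q : TM2.Stmt Γ₁ Λ σ₁) (v : σ₁) (w : σ₂)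
    (S : ∀ k, List (Γ₁ k)) (T : ∀ k, List (Γ₂ k)) :
    TM2.stepAux (embedLeft Γ₂ σ₂ f e q) (v, w) (sumStk S T) =
      ⟨some ((TM2.stepAux q v S).l.elim e f), ((TM2.stepAux q v S).var, w),
        sumStk (TM2.stepAux q v S).stk T⟩ := by
  induction q generalizing v S with
  | branch g q r ihq ihr =>
    simp only [embedLeft, TM2.stepAux]
    cases g v
    · exact ihr v S
    · exact ihq v S
  | push k g q ih =>
    simp only [embedLeft, TM2.stepAux]
    rw [← ih, ← update_sumStk_inl]; rfl
  | peek k g q ih => simp only [embedLeft, TM2.stepAux]; exact ih _ _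
  | pop k g q ih =>
    simp only [embedLeft, TM2.stepAux]
    rw [← ih, ← update_sumStk_inl]; rfl
  | load g q ih => simp only [embedLeft, TM2.stepAux]; exact ih _ _
  | goto g => simp [embedLeft, TM2.stepAux]
  | halt => simp [embedLeft, TM2.stepAux]

theorem stepAux_embedRight (f : Λ → Λ') (q : TM2.Stmt Γ₂ Λ σ₂) (v : σ₁) (w : σ₂)
    (S : ∀ k, List (Γ₁ k)) (T : ∀ k, List (Γ₂ k)) :
    TM2.stepAux (embedRight Γ₁ σ₁ f q) (v, w) (sumStk S T) =
      ⟨(TM2.stepAux q w T).l.map f, (v, (TM2.stepAux q w T).var),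
        sumStk S (TM2.stepAux q w T).stk⟩ := by
  induction q generalizing w T with
  | branch g q r ihq ihr =>
    simp only [embedRight, TM2.stepAux]
    cases g w
    · exact ihr w T
    · exact ihq w T
  | push k g q ih =>
    simp only [embedRight, TM2.stepAux]
    rw [← ih, ← update_sumStk_inr]; rfl
  | peek k g q ih => simp only [embedRight, TM2.stepAux]; exact ih _ _
  | pop k g q ih =>
    simp only [embedRight, TM2.stepAux]
    rw [← ih, ← update_sumStk_inr]; rfl
  | load g q ih => simp only [embedRight, TM2.stepAux]; exact ih _ _
  | goto g => simp [embedRight, TM2.stepAux]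
  | halt => simp [embedRight, TM2.stepAux]

end Embedding

/-- The stacks with the contents `l` on the stack `k`, all others being empty. -/
def single {K : Type} [DecidableEq K] (k : K) (l : List InSym) : Store K :=
  Function.update (fun _ => []) k l

section Precompose

variable {K : Type} [DecidableEq K]

/-- The code of the machine that runs the program `p`, moves the contents of the stack `out` to the
input stack of the machine `A`, and then runs `A`. -/
def precomposeCode (p : Prog K) (out : K) (A : TM2ComputableAux InSym Bool) :
    p.Λ ⊕ Option A.tm.Λ → TM2.Stmt (sumAlphabet (fun _ : K => InSym) A.tm.Γ)
      (p.Λ ⊕ Option A.tm.Λ) (Buffer × A.tm.σ)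
  | .inl l => embedLeft A.tm.Γ A.tm.σ .inl (.inr none) (p.m l)
  | .inr none =>
    .pop (.inl out) (fun v o => ((o, none), v.2))
      (.branch (fun v => v.1.1.isSome)
        (.push (.inr A.tm.k₀) (fun v => A.inputAlphabet.invFun (v.1.1.getD .pos))
          (.load (fun v => ((none, none), v.2)) (.goto fun _ => .inr none)))
        (.load (fun v => ((none, none), v.2)) (.goto fun _ => .inr (some A.tm.main))))
  | .inr (some l) => embedRight (fun _ : K => InSym) Buffer (fun l => .inr (some l)) (A.tm.m l)

theorem initList_eq (tm : FinTM2) (s : List (tm.Γ tm.k₀)) :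
    initList tm s = ⟨some tm.main, tm.initialState, Function.update (fun _ => []) tm.k₀ s⟩ := by
  unfold initList
  congr 1
  funext k
  by_cases h : k = tm.k₀
  · subst h
    simp
  · simp [h]

theorem haltList_eq (tm : FinTM2) (s : List (tm.Γ tm.k₁)) :
    haltList tm s = ⟨none, tm.initialState, Function.update (fun _ => []) tm.k₁ s⟩ := by
  unfold haltList
  congr 1
  funext k
  by_cases h : k = tm.k₁
  · subst h
    simp
  · simp [h]

/-- One step per symbol, and one more to notice that `out` is empty. Moving from stack to stack
reverses the word. -/
theorem steps_transfer (p : Prog K) (out : K) (A : TM2ComputableAux InSym Bool)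
    (w r : List InSym) :
    StepsIn (TM2.step (precomposeCode p out A)) (w.length + 1)
      ⟨some (.inr none), ((none, none), A.tm.initialState),
        sumStk (single out w) (Function.update (fun _ => []) A.tm.k₀
          (r.map A.inputAlphabet.invFun))⟩
      ⟨some (.inr (some A.tm.main)), ((none, none), A.tm.initialState),
        sumStk (fun _ => []) (Function.update (fun _ => []) A.tm.k₀
          ((w.reverse ++ r).map A.inputAlphabet.invFun))⟩ := by
  induction w generalizing r with
  | nil =>
    refine .single ?_
    simp [TM2.step, precomposeCode, sumStk, single]
  | cons a w ih =>
    refine .head ?_ (by simpa using ih (a :: r))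
    simp only [TM2.step, precomposeCode, TM2.stepAux]
    have h1 : sumStk (single out (a :: w)) (Function.update (fun _ => []) A.tm.k₀
          (r.map A.inputAlphabet.invFun)) (.inl out) = a :: w := by simp [sumStk, single]
    rw [h1, update_sumStk_inl]
    simp only [List.head?_cons, Option.isSome_some, cond_true, Option.getD_some, List.tail_cons]
    rw [update_sumStk_inr]
    simp [sumStk, single]

variable [Fintype K]

/-- The machine that runs a program on its input and a machine on the result. -/
def precompose (p : Prog K) (inp out : K) (A : TM2ComputableAux InSym Bool) :
    TM2ComputableAux InSym Bool where
  tm :=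
    { K := K ⊕ A.tm.K
      kDecidableEq := inferInstance
      kFin := letI := A.tm.kFin; inferInstance
      k₀ := .inl inp
      k₁ := .inr A.tm.k₁
      Γ := sumAlphabet (fun _ => InSym) A.tm.Γ
      Λ := p.Λ ⊕ Option A.tm.Λ
      main := .inl p.main
      ΛFin := letI := A.tm.ΛFin; inferInstance
      σ := Buffer × A.tm.σ
      initialState := ((none, none), A.tm.initialState)
      σFin := letI := A.tm.σFin; inferInstance
      Γk₀Fin := inferInstanceAs (Fintype InSym)
      m := precomposeCode p out A }
  inputAlphabet := Equiv.refl InSym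
  outputAlphabet := A.outputAlphabet

variable (p : Prog K) (inp out : K) (A : TM2ComputableAux InSym Bool)

/-- The run has three phases: `p` on the left stacks, the transfer, and `A` on the right stacks. The
transfer reverses, hence `p` has to leave `w'` reversed. Input and output configurations have all
other stacks empty and the memory in its initial state, so `p` must clean up everything except
`out`. -/
theorem outputs_precompose {w w' : List InSym} {b : List Bool} {t t' : ℕ}
    (hp : p.Run (single inp w) (single out w'.reverse) t)
    (hA : Nonempty (TM2OutputsInTime A.tm (w'.map A.inputAlphabet.invFun)
      (some (b.map A.outputAlphabet.invFun)) t')) :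
    Nonempty (TM2OutputsInTime (precompose p inp out A).tm
      (w.map (precompose p inp out A).inputAlphabet.invFun)
      (some (b.map (precompose p inp out A).outputAlphabet.invFun))
      (t + (w'.length + 1) + t')) := by
  obtain ⟨m, hm, hp⟩ := hp
  obtain ⟨⟨n, hA⟩, hn⟩ := hA
  have hA' := StepsIn.iff_iterate.2 hA
  rw [initList_eq, haltList_eq] at hA'
  have h1 : StepsIn (TM2.step (precomposeCode p out A)) m
      ⟨some (.inl p.main), ((none, none), A.tm.initialState),
        sumStk (single inp w) (fun _ => [])⟩
      ⟨some (.inr none), ((none, none), A.tm.initialState),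
        sumStk (single out w'.reverse) (fun _ => [])⟩ := by
    refine StepsIn.map (g := TM2.step (precomposeCode p out A))
      (fun c : TM2.Cfg (fun _ : K => InSym) p.Λ Buffer =>
        (⟨some (c.l.elim (.inr none) .inl), (c.var, A.tm.initialState),
          sumStk c.stk (fun _ => [])⟩ :
          TM2.Cfg (sumAlphabet (fun _ : K => InSym) A.tm.Γ) (p.Λ ⊕ Option A.tm.Λ)
            (Buffer × A.tm.σ))) ?_ hp
    rintro ⟨_ | l, v, S⟩ b hb
    · simp [TM2.step] at hb
    · simp only [TM2.step, Option.some.injEq] at hb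
      subst hb
      simp [TM2.step, precomposeCode, stepAux_embedLeft]
  have h2 := steps_transfer p out A w'.reverse []
  have h3 : StepsIn (TM2.step (precomposeCode p out A)) n
      ⟨some (.inr (some A.tm.main)), ((none, none), A.tm.initialState),
        sumStk (fun _ => []) (Function.update (fun _ => []) A.tm.k₀
          (w'.map A.inputAlphabet.invFun))⟩
      ⟨none, ((none, none), A.tm.initialState),
        sumStk (fun _ => []) (Function.update (fun _ => []) A.tm.k₁
          (b.map A.outputAlphabet.invFun))⟩ := by
    refine StepsIn.map (g := TM2.step (precomposeCode p out A))
      (fun c : TM2.Cfg A.tm.Γ A.tm.Λ A.tm.σ =>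
        (⟨c.l.map (fun l => .inr (some l)), ((none, none), c.var),
          sumStk (fun _ => []) c.stk⟩ :
          TM2.Cfg (sumAlphabet (fun _ : K => InSym) A.tm.Γ) (p.Λ ⊕ Option A.tm.Λ)
            (Buffer × A.tm.σ))) ?_ hA'
    rintro ⟨_ | l, v, S⟩ b hb
    · simp [TM2.step] at hb
    · simp only [FinTM2.step, TM2.step, Option.some.injEq] at hb
      subst hb
      simp [TM2.step, precomposeCode, stepAux_embedRight]
  simp only [List.map_nil, List.append_nil, List.reverse_reverse, List.length_reverse] at h2
  have h0 : Function.update (fun _ => []) A.tm.k₀ [] = fun k => ([] : List (A.tm.Γ k)) := by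
    simp
  rw [h0] at h2
  have h := (h1.trans h2).trans h3
  have hn' : n ≤ t' := hn
  refine ⟨⟨⟨m + (w'.length + 1) + n, ?_⟩, show m + (w'.length + 1) + n ≤ _ by omega⟩⟩
  refine StepsIn.iff_iterate.1 ?_
  rw [initList_eq, haltList_eq]
  have e1 : Function.update
      (fun k => ([] : List (sumAlphabet (fun _ : K => InSym) A.tm.Γ k))) (.inl inp) w =
      sumStk (single inp w) (fun k => ([] : List (A.tm.Γ k))) := by
    rw [single, ← update_sumStk_inl]
    congr 1
    funext k
    rcases k with k | k <;> rfl
  have e2 : Function.update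
      (fun k => ([] : List (sumAlphabet (fun _ : K => InSym) A.tm.Γ k))) (.inr A.tm.k₁)
      (b.map A.outputAlphabet.invFun) =
      sumStk (fun _ : K => ([] : List InSym)) (Function.update (fun _ => []) A.tm.k₁
          (b.map A.outputAlphabet.invFun)) := by
    rw [← update_sumStk_inr]
    congr 1
    funext k
    rcases k with k | k <;> rfl
  rw [← e1, ← e2] at h
  have hw : w.map (precompose p inp out A).inputAlphabet.invFun = w := List.map_id w
  rw [hw]
  exact h

end Precompose

/-- A many-one reduction computed by a program. -/
theorem SolvableInTime.precompose {K : Type} [DecidableEq K] [Fintype K] (p : Prog K) (inp out : K)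
    {I J : Type} {valid : I → Prop} {enc : I → List InSym} {yes : I → Prop} {T' : I → ℝ}
    {valid' : J → Prop} {enc' : J → List InSym} {yes' : J → Prop} {T : J → ℝ}
    (h : SolvableInTime valid' enc' yes' T) (r : I → J) (t : I → ℕ)
    (hvalid : ∀ x, valid x → valid' (r x)) (hyes : ∀ x, valid x → (yes x ↔ yes' (r x)))
    (hrun : ∀ x, valid x → p.Run (single inp (enc x)) (single out (enc' (r x)).reverse) (t x))
    (hT : ∀ x, valid x → (t x : ℝ) + ((enc' (r x)).length + 1) + T (r x) ≤ T' x) :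
    SolvableInTime valid enc yes T' := by
  obtain ⟨A, hA⟩ := h
  refine ⟨_root_.precompose p inp out A, fun x hx => ?_⟩
  obtain ⟨n, hn, hAn⟩ := hA (r x) (hvalid x hx)
  refine ⟨t x + ((enc' (r x)).length + 1) + n, ?_, ?_⟩
  · push_cast
    linarith [hT x hx]
  · rw [decide_eq_decide.2 (hyes x hx)]
    exact outputs_precompose p inp out A (hrun x hx) hAn

/-! ### Rounds of resolution -/

/-- The programs compare variables and literals as strings; injectivity of the encodings makes this
legitimate. Here the number is recovered from its bits by folding `Nat.bit`. -/
theorem encodeVar_injective : Function.Injective encodeVar := by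
  intro u v h
  have h' : u.bits = v.bits := List.map_injective_iff.2 (fun a b hab => by cases hab; rfl) h
  have key : ∀ n : ℕ, n.bits.foldr (fun b m => Nat.bit b m) 0 = n := by
    intro n
    induction n using Nat.binaryRec' with
    | zero => simp
    | bit b n hb ih => rw [Nat.bits_append_bit _ _ hb, List.foldr_cons, ih]
  rw [← key u, ← key v, h']

theorem encodeLiteral_injective : Function.Injective encodeLiteral := by
  rintro ⟨u, a⟩ ⟨v, b⟩ h
  simp only [encodeLiteral, List.cons.injEq] at h
  rw [encodeVar_injective h.2]
  cases a <;> cases b <;> simp_all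

/-- The symbol for the opposite sign. -/
def flipSign : InSym → InSym
  | .pos => .neg
  | .neg => .pos
  | a => a

/-- The encoding of the complementary literal. -/
def flipHead (w : List InSym) : List InSym := w.modifyHead flipSign

theorem flipHead_encodeLiteral (l : Literal) :
    flipHead (encodeLiteral l) = encodeLiteral (l.1, !l.2) := by
  rcases l with ⟨v, _ | _⟩ <;> rfl

namespace CNF

/-- The literals and end markers in the encoding of the clauses of a formula. -/
def tokens (φ : CNF) : List (List InSym) :=
  φ.flatMap fun C => C.map encodeLiteral ++ [[.endClause]]

/-- Remove from a clause the literal with encoding `w`. -/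
def removeLiteral (w : List InSym) (C : Clause) : Clause := C.filter fun l => encodeLiteral l ≠ w

/-- The clauses obtained from two clauses of `φ` by removing complementary literals. -/
def resolvents (φ : CNF) : CNF :=
  φ.tokens.flatMap fun w => φ.flatMap fun C => φ.map fun D =>
    removeLiteral w C ++ removeLiteral (flipHead w) D

/-- Add all resolvents to a formula. -/
def resolve (φ : CNF) : CNF := φ.resolvents ++ φ

/-- The clauses of `φ` all of whose variables are in `M`. -/
def restrict (M : List ℕ) (φ : CNF) : CNF := φ.filter fun C => ∀ l ∈ C, l.1 ∈ M

theorem mem_removeLiteral {w : List InSym} {C : Clause} {l : Literal} :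
    l ∈ removeLiteral w C ↔ l ∈ C ∧ encodeLiteral l ≠ w := by
  simp [removeLiteral]

theorem mem_resolvents {φ : CNF} {E : Clause} :
    E ∈ φ.resolvents ↔ ∃ w ∈ φ.tokens, ∃ C ∈ φ, ∃ D ∈ φ,
      removeLiteral w C ++ removeLiteral (flipHead w) D = E := by
  simp [resolvents]

/-- Soundness does not require that `w` occurs in `C` or its complement in `D`. A true literal of
`C` other than `w` survives. If it is `w`, then the complement of `w` is false, so the true literal
of `D` survives. For the end marker as `w` nothing is removed and the resolvent is `C ++ D`. -/
theorem satisfies_resolve {φ : CNF} {σ : ℕ → Bool} (h : ∀ C ∈ φ, ∃ l ∈ C, σ l.1 = l.2) :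
    ∀ C ∈ φ.resolve, ∃ l ∈ C, σ l.1 = l.2 := by
  intro E hE
  rcases List.mem_append.1 hE with hE | hE
  · obtain ⟨w, -, C, hC, D, hD, rfl⟩ := mem_resolvents.1 hE
    obtain ⟨l, hl, hσ⟩ := h C hC
    by_cases hw : encodeLiteral l = w
    · obtain ⟨l', hl', hσ'⟩ := h D hD
      refine ⟨l', List.mem_append_right _ (mem_removeLiteral.2 ⟨hl', fun he => ?_⟩), hσ'⟩
      rw [← hw, flipHead_encodeLiteral] at he
      rw [encodeLiteral_injective he] at hσ'
      rw [hσ] at hσ'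
      cases h2 : l.2 <;> simp [h2] at hσ'
    · exact ⟨l, List.mem_append_left _ (mem_removeLiteral.2 ⟨hl, hw⟩), hσ⟩
  · exact h E hE

/-- The bound is not `2 * k - 2`, because pairs of clauses without the literal resolved on are
concatenated too. -/
theorem IsKCNF.resolve {k : ℕ} {φ : CNF} (h : φ.IsKCNF k) : φ.resolve.IsKCNF (2 * k) := by
  intro E hE
  rcases List.mem_append.1 hE with hE | hE
  · obtain ⟨w, -, C, hC, D, hD, rfl⟩ := mem_resolvents.1 hE
    rw [List.length_append, two_mul]
    exact Nat.add_le_add ((List.length_filter_le _ _).trans (h C hC))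
      ((List.length_filter_le _ _).trans (h D hD))
  · exact (h E hE).trans (by omega)

theorem IsKCNF.iterate_resolve {k : ℕ} {φ : CNF} (h : φ.IsKCNF k) (c : ℕ) :
    (CNF.resolve^[c] φ).IsKCNF (2 ^ c * k) := by
  induction c with
  | zero => simpa using h
  | succ c ih =>
    rw [Function.iterate_succ_apply', pow_succ', mul_assoc]
    exact ih.resolve

theorem vars_restrict_subset (M : List ℕ) (φ : CNF) : (φ.restrict M).vars ⊆ M.toFinset := by
  intro v hv
  simp only [vars, List.mem_toFinset, List.mem_map, List.mem_flatten] at hv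
  obtain ⟨l, ⟨C, hC, hl⟩, rfl⟩ := hv
  have := (List.mem_filter.1 hC).2
  simp only [decide_eq_true_eq] at this
  simpa using this l hl

theorem IsKCNF.restrict {k : ℕ} {φ : CNF} (h : φ.IsKCNF k) (M : List ℕ) :
    (φ.restrict M).IsKCNF k := fun C hC => h C (List.mem_filter.1 hC).1

end CNF

/-! ### Eliminating the layers of a forest -/

/-- Layers (`low ℓ` holds for the elements of the lowest `ℓ` layers) and a comparability
relation that behave like those of a rooted forest. -/
structure Layering (low : ℕ → ℕ → Prop) (cmp : ℕ → ℕ → Prop) : Prop where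
  low_zero : ∀ x, ¬ low 0 x
  cmp_symm : ∀ x y, cmp x y → cmp y x
  eq_of_cmp : ∀ ℓ x y, low (ℓ + 1) x → ¬ low ℓ x → low (ℓ + 1) y → ¬ low ℓ y → cmp x y → x = y
  cmp_of_cmp : ∀ ℓ x y z, low (ℓ + 1) z → ¬ low ℓ z → low ℓ x → low ℓ y → cmp x z → cmp y z →
    cmp x y

/-- Outside `M`, the variables of `C` are in the lowest `ℓ` layers and pairwise comparable. -/
def IsChainClause (low : ℕ → ℕ → Prop) (cmp : ℕ → ℕ → Prop) (M : List ℕ) (ℓ : ℕ)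
    (C : Clause) : Prop :=
  (∀ l ∈ C, l.1 ∈ M ∨ low ℓ l.1) ∧
    ∀ l ∈ C, ∀ l' ∈ C, l.1 ∉ M → l'.1 ∉ M → cmp l.1 l'.1

open CNF in
-- Davis–Putnam elimination of a whole layer at once. Comparable variables of one layer coincide, so
-- each chain clause has at most one variable in the top layer, and the values of the top variables
-- can be chosen independently. Only resolvents that are chain clauses of the lower level are
-- needed.
theorem Layering.extend {low : ℕ → ℕ → Prop} {cmp : ℕ → ℕ → Prop} (L : Layering low cmp)
    {M : List ℕ} (hM : ∀ ℓ x, low ℓ x → x ∉ M) {ℓ : ℕ} {φ : CNF} {σ : ℕ → Bool}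
    (hσ : ∀ C ∈ φ.resolve, IsChainClause low cmp M ℓ C → ∃ l ∈ C, σ l.1 = l.2) :
    ∃ τ : ℕ → Bool, ∀ C ∈ φ, IsChainClause low cmp M (ℓ + 1) C → ∃ l ∈ C, τ l.1 = l.2 := by
  classical
  let top : ℕ → Prop := fun x => low (ℓ + 1) x ∧ ¬ low ℓ x
  -- A top variable is made true only if some clause needs it: all other literals of `D` are false
  -- under `σ`. Demanding also that they are on other variables excludes tautologies, so that
  -- removing `(x, true)` from `D` removes `x` altogether.
  let forced : ℕ → Prop := fun x => ∃ D ∈ φ, IsChainClause low cmp M (ℓ + 1) D ∧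
    (x, true) ∈ D ∧ ∀ l ∈ D, l ≠ (x, true) → l.1 ≠ x ∧ σ l.1 ≠ l.2
  let τ : ℕ → Bool := fun x => if top x then decide (forced x) else σ x
  have hτ : ∀ x, ¬ top x → τ x = σ x := fun x hx => if_neg hx
  have hτ' : ∀ x, top x → τ x = decide (forced x) := fun x hx => if_pos hx
  refine ⟨τ, fun C hC hchain => ?_⟩
  by_cases htop : ∃ l ∈ C, top l.1
  swap
  · push Not at htop
    obtain ⟨l, hl, h⟩ := hσ C (List.mem_append_right _ hC)
      ⟨fun l hl => (hchain.1 l hl).imp_right fun h => by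
        by_contra h'
        exact htop l hl ⟨h, h'⟩, hchain.2⟩
    exact ⟨l, hl, by rw [hτ _ (htop l hl), h]⟩
  obtain ⟨⟨v, b⟩, hvC, hv⟩ := htop
  have hvM : v ∉ M := hM _ _ hv.1
  have huniq : ∀ D, IsChainClause low cmp M (ℓ + 1) D → ∀ b', (v, b') ∈ D → ∀ l ∈ D,
      l.1 ≠ v → ¬ top l.1 := by
    intro D hD b' hb' l hl hlv ht
    exact hlv (L.eq_of_cmp ℓ _ _ ht.1 ht.2 hv.1 hv.2
      (hD.2 l hl _ hb' (hM _ _ ht.1) hvM))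
  by_contra hcon
  push Not at hcon
  -- `v` is the only top variable of `C`, so `τ` and `σ` agree on all other variables of `C`.
  have hfalse : ∀ l ∈ C, l.1 ≠ v → σ l.1 ≠ l.2 := by
    intro l hl hlv
    rw [← hτ _ (huniq C hchain b hvC l hl hlv)]
    exact hcon l hl
  have hforced : ¬ (v, true) ∈ C := by
    intro hpos
    have h1 := hcon _ hpos
    simp only [hτ' v hv, ne_eq, decide_eq_true_eq] at h1
    -- If `v` occurs positively in the falsified clause `C`, then `τ v` is false and `C` itself
    -- forces `v`. A literal `(v, false)` in `C` would be true under `τ`, so it cannot occur.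
    refine h1 ⟨C, hC, hchain, hpos, fun l hl hne => ?_⟩
    have hlv : l.1 ≠ v := by
      rintro rfl
      have h2 := hcon l hl
      have h3 : l.2 = false := by
        cases h : l.2 with
        | false => rfl
        | true => exact absurd (show l = (l.1, true) from Prod.ext rfl h) hne
      rw [h3, hτ' _ hv] at h2
      simp only [ne_eq, decide_eq_false_iff_not, not_not] at h2
      exact h1 h2
    exact ⟨hlv, hfalse l hl hlv⟩
  have hneg : (v, false) ∈ C := by
    cases b with
    | false => exact hvC
    | true => exact absurd hvC hforced
  have h1 := hcon _ hneg
  simp only [hτ' v hv, ne_eq, decide_eq_false_iff_not, not_not] at h1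
  obtain ⟨D, hD, hDchain, hvD, hDfalse⟩ := h1
  -- `C` contains `v` negatively and `D` forces `v`. Their resolvent on `v` has only literals false
  -- under `σ`, although it is a clause that `σ` has to satisfy.
  let w := encodeLiteral (v, true)
  have hmemD : ∀ l ∈ removeLiteral w D, l ∈ D ∧ l.1 ≠ v ∧ σ l.1 ≠ l.2 := by
    intro l hl
    obtain ⟨hl, hne⟩ := mem_removeLiteral.1 hl
    have h2 := hDfalse l hl (fun h => hne (by rw [h]))
    exact ⟨hl, h2.1, h2.2⟩
  have hmemC : ∀ l ∈ removeLiteral (flipHead w) C, l ∈ C ∧ l.1 ≠ v ∧ σ l.1 ≠ l.2 := by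
    intro l hl
    obtain ⟨hlC, hne⟩ := mem_removeLiteral.1 hl
    have hlv : l.1 ≠ v := by
      rintro rfl
      cases h : l.2 with
      | false =>
        refine hne ?_
        rw [flipHead_encodeLiteral]
        exact congrArg _ (Prod.ext rfl h)
      | true => exact hforced (by rw [← h]; exact hlC)
    exact ⟨hlC, hlv, hfalse l hlC hlv⟩
  have hlow : ∀ D, IsChainClause low cmp M (ℓ + 1) D → ∀ b', (v, b') ∈ D → ∀ l ∈ D,
      l.1 ≠ v → l.1 ∉ M → low ℓ l.1 ∧ cmp l.1 v := by
    intro D hD b' hb' l hl hlv hlM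
    refine ⟨?_, hD.2 l hl _ hb' hlM hvM⟩
    by_contra h'
    exact huniq D hD b' hb' l hl hlv ⟨(hD.1 l hl).resolve_left hlM, h'⟩
  -- Outside `M`, both clauses contribute only variables that lie below the top layer and are
  -- comparable to `v`. By `cmp_of_cmp` these are comparable to each other, so the resolvent is a
  -- chain clause of level `ℓ`.
  have hall : ∀ l ∈ removeLiteral w D ++ removeLiteral (flipHead w) C,
      l.1 ∉ M → low ℓ l.1 ∧ cmp l.1 v := by
    intro l hl hlM
    rcases List.mem_append.1 hl with hl | hl
    · exact hlow D hDchain _ hvD l (hmemD l hl).1 (hmemD l hl).2.1 hlM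
    · exact hlow C hchain _ hneg l (hmemC l hl).1 (hmemC l hl).2.1 hlM
  have hE : removeLiteral w D ++ removeLiteral (flipHead w) C ∈ φ.resolve := by
    refine List.mem_append_left _ (mem_resolvents.2 ⟨w, ?_, D, hD, C, hC, rfl⟩)
    refine List.mem_flatMap.2 ⟨D, hD, List.mem_append_left _ (List.mem_map_of_mem hvD)⟩
  obtain ⟨l, hl, hsat⟩ := hσ _ hE ⟨fun l hl => by
      by_cases h : l.1 ∈ M
      · exact .inl h
      · exact .inr (hall l hl h).1,
    fun l hl l' hl' h h' => L.cmp_of_cmp ℓ _ _ v hv.1 hv.2 (hall l hl h).1 (hall l' hl' h').1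
      (hall l hl h).2 (hall l' hl' h').2⟩
  rcases List.mem_append.1 hl with hl | hl
  · exact (hmemD l hl).2.2 hsat
  · exact (hmemC l hl).2.2 hsat

/-- The assignment is built from the lowest layer upwards, while the rounds of resolution are
undone: after `i` layers it satisfies the chain clauses of level `i` in the formula of round `c -
i`. -/
theorem Layering.satisfiable {low : ℕ → ℕ → Prop} {cmp : ℕ → ℕ → Prop} (L : Layering low cmp)
    {M : List ℕ} (hM : ∀ ℓ x, low ℓ x → x ∉ M) (c : ℕ) {φ : CNF}
    (hφ : ∀ C ∈ φ, IsChainClause low cmp M c C)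
    (h : ((CNF.resolve^[c] φ).restrict M).Satisfiable) : φ.Satisfiable := by
  have key : ∀ i ≤ c, ∃ σ : ℕ → Bool, ∀ C ∈ CNF.resolve^[c - i] φ,
      IsChainClause low cmp M i C → ∃ l ∈ C, σ l.1 = l.2 := by
    intro i
    induction i with
    | zero =>
      intro _
      obtain ⟨σ, hσ⟩ := h
      -- No variable is in the lowest 0 layers, so a chain clause of level 0 lies entirely over `M`
      -- and survives the restriction.
      refine ⟨σ, fun C hC hchain => hσ C (List.mem_filter.2 ⟨hC, ?_⟩)⟩
      simp only [decide_eq_true_eq]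
      exact fun l hl => (hchain.1 l hl).resolve_right (L.low_zero _)
    | succ i ih =>
      intro hi
      obtain ⟨σ, hσ⟩ := ih (by omega)
      rw [show c - i = (c - (i + 1)) + 1 by omega, Function.iterate_succ_apply'] at hσ
      exact L.extend hM hσ
  obtain ⟨σ, hσ⟩ := key c le_rfl
  rw [Nat.sub_self] at hσ
  exact ⟨σ, fun C hC => hσ C hC (hφ C hC)⟩

/-! ### Ancestors in a rooted forest -/

section Forest

variable {V : Type} {parent : V → Option V}

theorem nthAncestor_add (i j : ℕ) (v : V) :
    nthAncestor parent (i + j) v = (nthAncestor parent i v).bind (nthAncestor parent j) := by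
  induction j with
  | zero => cases h : nthAncestor parent i v <;> simp [nthAncestor]
  | succ j ih =>
    rw [← Nat.add_assoc, nthAncestor, ih]
    cases nthAncestor parent i v <;> rfl

theorem nthAncestor_of_eq_some {i j : ℕ} {u v : V} (h : nthAncestor parent i u = some v) :
    nthAncestor parent (i + j) u = nthAncestor parent j v := by
  rw [nthAncestor_add, h]; rfl

theorem nthAncestor_none_mono {i j : ℕ} (hij : i ≤ j) {v : V} (h : nthAncestor parent i v = none) :
    nthAncestor parent j v = none := by
  obtain ⟨d, rfl⟩ := Nat.exists_eq_add_of_le hij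
  rw [nthAncestor_add, h]; rfl

/-- One of the vertices is an ancestor of the other. -/
def ForestComparable (parent : V → Option V) (u v : V) : Prop :=
  (∃ i, nthAncestor parent i u = some v) ∨ ∃ i, nthAncestor parent i v = some u

/-- Both vertices have depth exactly `ℓ`, counting roots as depth 0. A proper descendant of a vertex
of depth `ℓ` has a root path that is too long. -/
theorem eq_of_forestComparable {ℓ : ℕ} {u v : V} (hu : nthAncestor parent (ℓ + 1) u = none)
    (hu' : nthAncestor parent ℓ u ≠ none) (hv : nthAncestor parent (ℓ + 1) v = none)
    (hv' : nthAncestor parent ℓ v ≠ none) (h : ForestComparable parent u v) : u = v := by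
  have key : ∀ {u v : V} (i : ℕ), nthAncestor parent (ℓ + 1) u = none →
      nthAncestor parent ℓ v ≠ none → nthAncestor parent i u = some v → u = v := by
    intro u v i hu hv h
    cases i with
    | zero => exact Option.some.inj h
    | succ i =>
      rw [← nthAncestor_of_eq_some (j := ℓ) h] at hv
      exact absurd (nthAncestor_none_mono (by omega) hu) hv
  rcases h with ⟨i, h⟩ | ⟨i, h⟩
  · exact key i hu hv' h
  · exact (key i hv hu' h).symm

/-- `u` and `v` are less deep than `w`, so they cannot be descendants of `w`. Hence both are
ancestors of `w` and lie on the same root path. -/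
theorem ForestComparable.trans_top {ℓ : ℕ} {u v w : V} (hw : nthAncestor parent ℓ w ≠ none)
    (hu : nthAncestor parent ℓ u = none) (hv : nthAncestor parent ℓ v = none)
    (h : ForestComparable parent u w) (h' : ForestComparable parent v w) :
    ForestComparable parent u v := by
  have key : ∀ {u : V}, nthAncestor parent ℓ u = none → ForestComparable parent u w →
      ∃ i, nthAncestor parent i w = some u := by
    rintro u hu (⟨i, h⟩ | h)
    · rw [← nthAncestor_of_eq_some (j := ℓ) h] at hw
      exact absurd (nthAncestor_none_mono (by omega) hu) hw
    · exact h
  obtain ⟨i, hi⟩ := key hu h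
  obtain ⟨j, hj⟩ := key hv h'
  rcases le_total i j with hij | hij
  · obtain ⟨d, rfl⟩ := Nat.exists_eq_add_of_le hij
    rw [nthAncestor_of_eq_some hi] at hj
    exact .inl ⟨d, hj⟩
  · obtain ⟨d, rfl⟩ := Nat.exists_eq_add_of_le hij
    rw [nthAncestor_of_eq_some hj] at hi
    exact .inr ⟨d, hi⟩

end Forest

/-- Rounds of resolution reduce the satisfiability of a formula to its modulator. -/
theorem satisfiable_restrict_iff {φ : CNF} {M : List ℕ} {c : ℕ}
    (h : HasTreeDepthAtMost (φ.primalGraphSub M) c) :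
    ((CNF.resolve^[c] φ).restrict M).Satisfiable ↔ φ.Satisfiable := by
  constructor
  swap
  · rintro ⟨σ, hσ⟩
    have hall : ∀ i, ∀ C ∈ CNF.resolve^[i] φ, ∃ l ∈ C, σ l.1 = l.2 := by
      intro i
      induction i with
      | zero => exact hσ
      | succ i ih =>
        rw [Function.iterate_succ_apply']
        exact CNF.satisfies_resolve ih
    exact ⟨σ, fun C hC => hall c C (List.mem_filter.1 hC).1⟩
  obtain ⟨parent, hdepth, hadj⟩ := h
  -- A vertex is in the lowest `ℓ` layers if its root path has at most `ℓ` vertices; by `hdepth`,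
  -- all vertices are in the lowest `c`. Asking for a vertex named `x` ensures that `x` is not in
  -- `M`.
  let low : ℕ → ℕ → Prop := fun ℓ x => ∃ v, v.1.1 = x ∧ nthAncestor parent ℓ v = none
  let cmp : ℕ → ℕ → Prop := fun x y => ∃ u v, u.1.1 = x ∧ v.1.1 = y ∧ ForestComparable parent u v
  have hinj : ∀ u v : {v : {v // v ∈ φ.vars} | v.1 ∉ M}, u.1.1 = v.1.1 → u = v :=
    fun u v huv => Subtype.ext (Subtype.ext huv)
  have L : Layering low cmp := by
    refine ⟨?_, ?_, ?_, ?_⟩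
    · rintro x ⟨v, -, hv⟩
      simp [nthAncestor] at hv
    · rintro x y ⟨u, v, hu, hv, h⟩
      exact ⟨v, u, hv, hu, h.symm⟩
    · rintro ℓ x y ⟨u, rfl, hu⟩ hx ⟨v, rfl, hv⟩ hy ⟨u', v', hu', hv', h⟩
      rw [hinj _ _ hu', hinj _ _ hv'] at h
      rw [eq_of_forestComparable hu (fun e => hx ⟨u, rfl, e⟩) hv (fun e => hy ⟨v, rfl, e⟩) h]
    · rintro ℓ x y z ⟨w, rfl, hw⟩ hz ⟨u, rfl, hu⟩ ⟨v, rfl, hv⟩ ⟨u', w', hu', hw', h⟩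
        ⟨v', w'', hv', hw'', h'⟩
      rw [hinj _ _ hu', hinj _ _ hw'] at h
      rw [hinj _ _ hv', hinj _ _ hw''] at h'
      exact ⟨u, v, rfl, rfl, h.trans_top (fun e => hz ⟨w, rfl, e⟩) hu hv h'⟩
  refine L.satisfiable (fun ℓ x ⟨v, hv, _⟩ => hv ▸ v.2) c (fun C hC => ?_)
  have hvar : ∀ l ∈ C, l.1 ∈ φ.vars := by
    intro l hl
    simp only [CNF.vars, List.mem_toFinset, List.mem_map, List.mem_flatten]
    exact ⟨l, ⟨C, hC, hl⟩, rfl⟩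
  refine ⟨fun l hl => ?_, fun l hl l' hl' h h' => ?_⟩
  · by_cases hlM : l.1 ∈ M
    · exact .inl hlM
    · exact .inr ⟨⟨⟨l.1, hvar l hl⟩, hlM⟩, rfl, hdepth _⟩
  · refine ⟨⟨⟨l.1, hvar l hl⟩, h⟩, ⟨⟨l'.1, hvar l' hl'⟩, h'⟩, rfl, rfl, ?_⟩
    -- Literals on the same variable give no edge, but a vertex is its own ancestor at distance 0.
    by_cases he : l.1 = l'.1
    · refine .inl ⟨0, ?_⟩
      simp [nthAncestor, he]
    · refine hadj _ _ ⟨?_, C, hC, ⟨l, hl, rfl⟩, ⟨l', hl', rfl⟩⟩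
      simpa using he

/-! ### Basic programs -/

/-- The stacks of the programs below. -/
inductive Reg where
  | inp | out | phi | a | l | nl | b | c | e | d | f | w | x | y | t | flag
  deriving DecidableEq

instance : Fintype Reg where
  elems := {.inp, .out, .phi, .a, .l, .nl, .b, .c, .e, .d, .f, .w, .x, .y, .t, .flag}
  complete r := by cases r <;> decide

/-- The test for a bit. -/
def isBit : Option InSym → Bool
  | some (.bit _) => true
  | _ => false

/-- A string consisting of one symbol that is not a bit and of bits after it. -/
def IsToken (w : List InSym) : Prop :=
  ∃ h bs, w = h :: bs ∧ isBit (some h) = false ∧ ∀ a ∈ bs, isBit (some a) = true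

/-- A test that depends on one stack only. -/
abbrev onFst (c : Option InSym → Bool) (a _ : Option InSym) : Bool := c a

namespace Prog

variable {K : Type} [DecidableEq K] {s : Store K} {X Y T : K}

/-- Move the top symbol of `X` to `Y`, applying `f` to it. -/
def move (X Y : K) (f : InSym → InSym) : Prog K := (dup X Y f).seq (pop X)

theorem run_move (hXY : X ≠ Y) (f : InSym → InSym) {a : InSym} {r : List InSym}
    (h : s X = a :: r) :
    (move X Y f).Run s (Function.update (Function.update s X r) Y (f a :: s Y)) 2 := by
  refine ((run_dup f h).seq (run_pop X)).congr ?_ le_rfl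
  rw [Function.update_of_ne hXY, h, Function.update_comm hXY]
  rfl

/-- Move symbols from `X` to `Y` as long as they satisfy `c`. -/
def moveWhile (X Y : K) (c : Option InSym → Bool) : Prog K := loop X X (onFst c) (move X Y id)

theorem run_moveWhile (hXY : X ≠ Y) {c : Option InSym → Bool} {u r : List InSym}
    (hu : ∀ a ∈ u, c (some a) = true) (hr : c r.head? = false) (h : s X = u ++ r) :
    (moveWhile X Y c).Run s
      (Function.update (Function.update s X r) Y (u.reverse ++ s Y)) (3 * u.length + 1) := by
  refine Run.congr (s₁ := Function.update (Function.update s X ([] ++ r)) Y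
      (u.foldl (fun o i => ([i] : List InSym).reverse ++ o) (s Y)))
    (t₁ := u.length * (2 + 1) + 1) ?_ ?_ (by omega)
  · have := run_loop_items (p := move X Y id) (X := X) (Y := X) (c := onFst c)
      (fun is b => Function.update (Function.update s X (is ++ r)) Y b)
      (fun o i => ([i] : List InSym).reverse ++ o)
      (fun is _ => ∀ a ∈ is, c (some a) = true) (fun i is _ hi a ha => hi a (.tail _ ha)) 2
      (fun i is b hi => by simpa [hXY] using hi i (.head _))
      (fun b => by simpa [hXY] using hr)
      (fun i is b hi => by
        refine (run_move hXY id (a := i) (r := is ++ r) (by simp [hXY])).congr ?_ le_rfl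
        rw [Function.update_comm hXY]
        simp [Function.update_comm hXY])
      u (s Y) hu
    simpa [← h, moveWhile] using this
  · rw [foldl_emit (fun i => [i])]
    simp

/-- Move the contents of `X` to `Y`, reversing their order. -/
def moveAll (X Y : K) : Prog K := moveWhile X Y Option.isSome

theorem run_moveAll (hXY : X ≠ Y) :
    (moveAll X Y).Run s (Function.update (Function.update s X []) Y ((s X).reverse ++ s Y))
      (3 * (s X).length + 1) :=
  run_moveWhile hXY (fun _ _ => rfl) rfl (by simp)

/-- Empty the stack `X`. -/
def clear (X : K) : Prog K := loop X X (onFst Option.isSome) (pop X)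

theorem run_clear : (clear X).Run s (Function.update s X []) (2 * (s X).length + 1) := by
  have := run_loop_items (p := pop X) (X := X) (Y := X) (c := onFst Option.isSome)
      (fun is (_ : Unit) => Function.update s X is) (fun o _ => o)
      (fun _ _ => True) (fun _ _ _ _ => trivial) 1
      (fun i is b _ => by simp) (fun b => by simp)
      (fun i is b _ => (run_pop X).congr (by simp) le_rfl) (s X) () trivial
  exact (by simpa [clear] using this : Run (clear X) _ _ _).mono (by omega)

/-- Put a copy of the contents of `X` on top of `Y`, using the empty stack `T`. -/
def copy (T X Y : K) : Prog K :=
  (moveAll X T).seq (loop T T (onFst Option.isSome)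
    ((dup T X id).seq ((dup T Y id).seq (pop T))))

/-- Reversing `X` into `T` costs `3n + 1` steps; restoring `X` from `T` while writing to `Y` as well
costs `4n + 1` and reverses again. -/
theorem run_copy (hTX : T ≠ X) (hTY : T ≠ Y) (hXY : X ≠ Y) (hT : s T = []) :
    (copy T X Y).Run s (Function.update s Y (s X ++ s Y)) (7 * (s X).length + 2) := by
  have h2 := run_loop_items (p := (dup T X id).seq ((dup T Y id).seq (pop T)))
      (X := T) (Y := T) (c := onFst Option.isSome)
      (fun is (o : List InSym) => Function.update (Function.update (Function.update s X o) T is) Y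
        (o ++ s Y)) (fun o i => ([i] : List InSym).reverse ++ o)
      (fun _ _ => True) (fun _ _ _ _ => trivial) 3
      (fun i is b _ => by simp [hTY]) (fun b => by simp [hTY])
      (fun i is b _ => by
        refine ((run_dup id (a := i) (r := is) (by simp [hTY])).seq
          ((run_dup id (a := i) (r := is) (by simp [hTX, hTY])).seq (run_pop T))).congr ?_ le_rfl
        funext k
        simp only [Function.update_apply]
        split_ifs <;> simp_all)
      (s X).reverse [] trivial
  rw [foldl_emit (fun i => [i])] at h2
  refine ((run_moveAll hTX.symm).seq (h2.congr rfl le_rfl |> fun h => ?_)).congr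
    (s₁ := Function.update s Y (s X ++ s Y))
    (t₁ := 3 * (s X).length + 1 + ((s X).reverse.length * (3 + 1) + 1)) rfl
    (by simp; omega)
  convert h using 1
  · funext k
    simp only [Function.update_apply]
    split_ifs <;> simp_all
  · funext k
    simp only [Function.update_apply]
    split_ifs <;> simp_all

/-- Move the first token of `X` to `W`, using the empty stack `T`. -/
def splitToken (T X W : K) : Prog K :=
  (move X T id).seq ((moveWhile X T isBit).seq (moveAll T W))

/-- Tokens need no separators: the leading symbol is not a bit, and the token ends before the next
symbol that is not a bit. The detour through `T` restores the order. -/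
theorem run_splitToken {W : K} (hTX : T ≠ X) (hTW : T ≠ W) (hXW : X ≠ W) (hT : s T = [])
    {w r : List InSym} (hw : IsToken w) (hr : isBit r.head? = false) (h : s X = w ++ r) :
    (splitToken T X W).Run s (Function.update (Function.update s X r) W (w ++ s W))
      (6 * w.length + 1) := by
  obtain ⟨a, u, rfl, -, hu⟩ := hw
  refine ((run_move hTX.symm id (a := a) (r := u ++ r) (by simpa using h)).seq
    ((run_moveWhile hTX.symm hu hr (by simp [hTX.symm])).seq (run_moveAll hTW))).congr ?_ ?_
  · funext k
    simp only [Function.update_apply]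
    split_ifs <;> simp_all
  · simp [hT]
    omega

/-- Move the symbols of `X` before the first end marker `m` to `C`, removing the marker and using
the empty stack `T`. -/
def splitUntil (m : InSym) (T X C : K) : Prog K :=
  (moveWhile X T (fun o => o.isSome && o != some m)).seq
    ((pop X).seq (moveAll T C))

theorem run_splitUntil {C : K} {m : InSym} (hTX : T ≠ X) (hTC : T ≠ C) (hXC : X ≠ C) (hT : s T = [])
    {w r : List InSym} (hw : m ∉ w) (h : s X = w ++ m :: r) :
    (splitUntil m T X C).Run s (Function.update (Function.update s X r) C (w ++ s C))
      (6 * w.length + 3) := by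
  refine ((run_moveWhile hTX.symm (u := w) (r := m :: r) (fun a ha => ?_) (by simp)
    h).seq ((run_pop X).seq (run_moveAll hTC))).congr ?_ ?_
  · simp only [Option.isSome_some, Bool.true_and, bne_iff_ne, ne_eq, Option.some.injEq]
    rintro rfl
    exact hw ha
  · funext k
    simp only [Function.update_apply]
    split_ifs <;> simp_all
  · simp [hT, hTX]
    omega

/-- Empty `X` and `Y`, and push a symbol on `F` if their contents were equal. -/
def compare (X Y F : K) : Prog K :=
  (loop X Y (fun a b => a.isSome && a == b) ((pop X).seq (pop Y))).seq
    ((ite X Y (fun a b => a.isNone && b.isNone) (push F .pos) skip).seq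
      ((clear X).seq (clear Y)))

/-- Removing equal first symbols does not change whether the two words are equal. When the loop
stops, either the first word is used up or the tops differ, so the words were equal exactly when
both remainders are empty. -/
theorem exists_run_compare_loop (hXY : X ≠ Y) (u v : List InSym) (s : Store K) (hu : s X = u)
    (hv : s Y = v) : ∃ u' v', (u = v ↔ u' = v') ∧ u'.length ≤ u.length ∧ v'.length ≤ v.length ∧
      (u'.head?.isSome && u'.head? == v'.head?) = false ∧
      (loop X Y (fun a b => a.isSome && a == b) ((pop X).seq (pop Y))).Run s
        (Function.update (Function.update s X u') Y v') (3 * u.length + 1) := by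
  induction u generalizing v s with
  | nil =>
    exact ⟨[], v, Iff.rfl, le_rfl, le_rfl, rfl, (run_loop_false (by simp [hu])).congr
      (by rw [← hu, ← hv]; simp) (by simp)⟩
  | cons a u ih =>
    by_cases hends : ((a :: u).head?.isSome && (a :: u).head? == v.head?) = false
    · exact ⟨a :: u, v, Iff.rfl, le_rfl, le_rfl, hends, (run_loop_false
        (by rw [hu, hv]; exact hends)).congr (by rw [← hu, ← hv]; simp) (by simp)⟩
    obtain ⟨v, rfl⟩ : ∃ v', v = a :: v' := by
      cases v <;> simp_all
    have hbody : ((pop X).seq (pop Y)).Run s (Function.update (Function.update s X u) Y v) 2 :=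
      ((run_pop X).seq (run_pop Y)).congr (by simp [hu, hv, hXY.symm]) le_rfl
    obtain ⟨u', v', h1, h2, h3, h4, h5⟩ :=
      ih v (Function.update (Function.update s X u) Y v) (by simp [hXY]) (by simp)
    refine ⟨u', v', by simpa using h1, by simp; omega, by simp; omega, h4,
      (hbody.loop_true (by rw [hu, hv]; simp) h5).congr ?_ (by simp; omega)⟩
    funext k
    simp only [Function.update_apply]
    split_ifs <;> simp_all

theorem run_compare {F : K} (hXY : X ≠ Y) (hXF : X ≠ F) (hYF : Y ≠ F) :
    (compare X Y F).Run s (Function.update (Function.update (Function.update s X []) Y []) F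
      (if s X = s Y then .pos :: s F else s F)) (5 * ((s X).length + (s Y).length) + 5) := by
  obtain ⟨u, v, huv, hu, hv, hends, hloop⟩ := exists_run_compare_loop hXY (s X) (s Y) s rfl rfl
  have h1 : (ite X Y (fun a b => a.isNone && b.isNone) (push F .pos) skip).Run
      (Function.update (Function.update s X u) Y v)
      (Function.update (Function.update (Function.update s X u) Y v) F
        (if s X = s Y then .pos :: s F else s F)) 2 := by
    by_cases hnil : u = [] ∧ v = []
    · obtain ⟨rfl, rfl⟩ := hnil
      refine (Run.ite_true (by simp [hXY]) (run_push F .pos)).congr ?_ le_rfl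
      simp [huv, hXF.symm, hYF.symm]
    · have hne : u ≠ v := by
        rintro rfl
        cases u <;> simp_all
      refine (Run.ite_false ?_ run_skip).congr ?_ le_rfl
      · simp only [Function.update_self, Function.update_of_ne hXY]
        cases u <;> cases v <;> simp_all
      · simp [huv, hne, hXF.symm, hYF.symm]
  refine (hloop.seq (h1.seq (run_clear.seq run_clear))).congr ?_ ?_
  · funext k
    simp only [Function.update_apply]
    split_ifs <;> simp_all
  · simp [hXY, hXY.symm, hXF, hYF]
    omega

end Prog

/-! ### Programs on a fixed collection of stacks -/

/-- The contents of the stacks. -/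
structure Regs where
  (inp out phi a l nl b c e d f w x y t flag : List InSym)

namespace Regs

/-- The contents of one stack. -/
@[simp] def get (R : Regs) : Store Reg
  | .inp => R.inp | .out => R.out | .phi => R.phi | .a => R.a | .l => R.l | .nl => R.nl
  | .b => R.b | .c => R.c | .e => R.e | .d => R.d | .f => R.f | .w => R.w | .x => R.x
  | .y => R.y | .t => R.t | .flag => R.flag

/-- Replace the contents of one stack. -/
@[simp] def set (R : Regs) (k : Reg) (u : List InSym) : Regs :=
  match k with
  | .inp => { R with inp := u } | .out => { R with out := u } | .phi => { R with phi := u }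
  | .a => { R with a := u } | .l => { R with l := u } | .nl => { R with nl := u }
  | .b => { R with b := u } | .c => { R with c := u } | .e => { R with e := u }
  | .d => { R with d := u } | .f => { R with f := u } | .w => { R with w := u }
  | .x => { R with x := u } | .y => { R with y := u } | .t => { R with t := u }
  | .flag => { R with flag := u }

/-- This translates updates of functions into updates of records, so that explicit states can be
compared field by field. -/
theorem update_get (R : Regs) (k : Reg) (u : List InSym) :
    Function.update R.get k u = (R.set k u).get := by
  funext j
  by_cases h : j = k
  · subst h
    rw [Function.update_self]
    cases j <;> rfl
  · rw [Function.update_of_ne h]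
    cases k <;> cases j <;> first | rfl | exact absurd rfl h

theorem get_set_self (R : Regs) (k : Reg) (u : List InSym) : (R.set k u).get k = u := by
  cases k <;> rfl

theorem get_set_of_ne (R : Regs) {j k : Reg} (h : j ≠ k) (u : List InSym) :
    (R.set k u).get j = R.get j := by
  rw [← update_get, Function.update_of_ne h]

theorem set_get (R : Regs) (k : Reg) : R.set k (R.get k) = R := by
  cases k <;> rfl

end Regs

namespace Prog

/-- Started on the stacks `R`, the program halts with the stacks `R'` after at most `n` steps. -/
def Exec (p : Prog Reg) (R R' : Regs) (n : ℕ) : Prop := p.Run R.get R'.get n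

namespace Exec

variable {p q : Prog Reg} {R R₁ R₂ : Regs} {n n₁ n₂ : ℕ} {X Y : Reg}
  {c : Option InSym → Option InSym → Bool}

theorem congr (h : p.Exec R R₁ n₁) (hR : R₁ = R₂) (hn : n₁ ≤ n₂) : p.Exec R R₂ n₂ :=
  hR ▸ Run.mono h hn

theorem seq (hp : p.Exec R R₁ n₁) (hq : q.Exec R₁ R₂ n₂) : (p.seq q).Exec R R₂ (n₁ + n₂) :=
  Run.seq hp hq

theorem ite_true (hc : c (R.get X).head? (R.get Y).head? = true) (hp : p.Exec R R₁ n) :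
    (ite X Y c p q).Exec R R₁ (n + 1) :=
  Run.ite_true hc hp

theorem ite_false (hc : c (R.get X).head? (R.get Y).head? = false) (hq : q.Exec R R₁ n) :
    (ite X Y c p q).Exec R R₁ (n + 1) :=
  Run.ite_false hc hq

end Exec

variable {R : Regs}

theorem exec_skip : (skip : Prog Reg).Exec R R 1 := run_skip

theorem exec_push (X : Reg) (a : InSym) : (push X a).Exec R (R.set X (a :: R.get X)) 1 := by
  unfold Exec
  rw [← Regs.update_get]
  exact run_push X a

theorem exec_pop (X : Reg) : (pop X).Exec R (R.set X (R.get X).tail) 1 := by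
  unfold Exec
  rw [← Regs.update_get]
  exact run_pop X

theorem exec_move {X Y : Reg} (hXY : X ≠ Y) (f : InSym → InSym) {a : InSym} {r : List InSym}
    (h : R.get X = a :: r) :
    (move X Y f).Exec R ((R.set X r).set Y (f a :: R.get Y)) 2 := by
  unfold Exec
  rw [← Regs.update_get, ← Regs.update_get]
  exact run_move hXY f h

theorem exec_moveAll {X Y : Reg} (hXY : X ≠ Y) :
    (moveAll X Y).Exec R ((R.set X []).set Y ((R.get X).reverse ++ R.get Y))
      (3 * (R.get X).length + 1) := by
  unfold Exec
  rw [← Regs.update_get, ← Regs.update_get]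
  exact run_moveAll hXY

theorem exec_clear (X : Reg) : (clear X).Exec R (R.set X []) (2 * (R.get X).length + 1) := by
  unfold Exec
  rw [← Regs.update_get]
  exact run_clear

theorem exec_copy {X Y : Reg} (hX : .t ≠ X) (hY : .t ≠ Y) (hXY : X ≠ Y) (ht : R.t = []) :
    (copy .t X Y).Exec R (R.set Y (R.get X ++ R.get Y)) (7 * (R.get X).length + 2) := by
  unfold Exec
  rw [← Regs.update_get]
  exact run_copy hX hY hXY ht

theorem exec_splitToken {X W : Reg} (hX : .t ≠ X) (hW : .t ≠ W) (hXW : X ≠ W) (ht : R.t = [])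
    {w r : List InSym} (hw : IsToken w) (hr : isBit r.head? = false) (h : R.get X = w ++ r) :
    (splitToken .t X W).Exec R ((R.set X r).set W (w ++ R.get W)) (6 * w.length + 1) := by
  unfold Exec
  rw [← Regs.update_get, ← Regs.update_get]
  exact run_splitToken hX hW hXW ht hw hr h

theorem exec_splitUntil {X C : Reg} {m : InSym} (hX : .t ≠ X) (hC : .t ≠ C) (hXC : X ≠ C) (ht : R.t = [])
    {w r : List InSym} (hw : m ∉ w) (h : R.get X = w ++ m :: r) :
    (splitUntil m .t X C).Exec R ((R.set X r).set C (w ++ R.get C)) (6 * w.length + 3) := by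
  unfold Exec
  rw [← Regs.update_get, ← Regs.update_get]
  exact run_splitUntil hX hC hXC ht hw h

theorem exec_compare {X Y F : Reg} (hXY : X ≠ Y) (hXF : X ≠ F) (hYF : Y ≠ F) :
    (compare X Y F).Exec R (((R.set X []).set Y []).set F
      (if R.get X = R.get Y then .pos :: R.get F else R.get F))
      (5 * ((R.get X).length + (R.get Y).length) + 5) := by
  unfold Exec
  rw [← Regs.update_get, ← Regs.update_get, ← Regs.update_get]
  exact run_compare hXY hXF hYF

/-! ### Emitting strings in loops -/

theorem isBit_head_flatMap {ι : Type} {enc : ι → List InSym} {is : List ι}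
    (h : ∀ i ∈ is, IsToken (enc i)) : isBit (is.flatMap enc).head? = false := by
  cases is with
  | nil => rfl
  | cons i is =>
    obtain ⟨a, u, hw, ha, -⟩ := h i (.head _)
    simpa [hw] using ha

theorem _root_.IsToken.ne_nil {w : List InSym} (h : IsToken w) : w ≠ [] := by
  obtain ⟨a, u, rfl, -, -⟩ := h
  simp

/-- A loop that works through the items on the stack `X` and stores its state on the stack `Y`. -/
theorem exec_loop_fold {ι β : Type} {X Y : Reg} (hXY : X ≠ Y) {p : Prog Reg}
    (enc : ι → List InSym) (encState : β → List InSym) (g : β → ι → β) (I : β → Prop)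
    {items : List ι} (hI : ∀ b, ∀ i ∈ items, I b → I (g b i)) (henc : ∀ i ∈ items, enc i ≠ [])
    (B : ℕ)
    (hbody : ∀ i is b, (∀ j ∈ i :: is, j ∈ items) → I b →
      p.Exec ((R.set X (enc i ++ is.flatMap enc)).set Y (encState b))
        ((R.set X (is.flatMap enc)).set Y (encState (g b i))) B)
    (h : R.get X = items.flatMap enc) {b : β} (hb : I b) (h' : R.get Y = encState b) :
    (loop X X (onFst Option.isSome) p).Exec R
      ((R.set X []).set Y (encState (items.foldl g b))) (items.length * (B + 1) + 1) := by
  have := run_loop_items (p := p) (X := X) (Y := X) (c := onFst Option.isSome)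
      (fun is o => ((R.set X (is.flatMap enc)).set Y (encState o)).get) g
      (fun is b => (∀ j ∈ is, j ∈ items) ∧ I b)
      (fun i is b hi => ⟨fun a ha => hi.1 a (.tail _ ha), hI b i (hi.1 i (.head _)) hi.2⟩) B
      (fun i is b hi => by
        -- The loop stops at an empty stack, hence every remaining item must show at least one
        -- symbol.
        obtain ⟨a, u, hau⟩ := List.exists_cons_of_ne_nil (henc i (hi.1 i (.head _)))
        simp only [onFst, Regs.get_set_of_ne _ hXY, Regs.get_set_self, List.flatMap_cons]
        rw [hau]
        rfl)
      (fun b => by simp only [Regs.get_set_of_ne _ hXY, Regs.get_set_self, onFst]; rfl)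
      (fun i is b hi => hbody i is b hi.1 hi.2) items b ⟨fun _ h => h, hb⟩
  rw [← h, ← h', Regs.set_get, Regs.set_get] at this
  exact this

/-- A loop that works through the items on the stack `X` and pushes strings on the stack `Y`. -/
theorem exec_loop_emit {ι : Type} {X Y : Reg} (hXY : X ≠ Y) {p : Prog Reg}
    (enc : ι → List InSym) (g : List InSym → ι → List InSym) {items : List ι}
    (henc : ∀ i ∈ items, enc i ≠ []) (B : ℕ)
    (hbody : ∀ i is o, (∀ j ∈ i :: is, j ∈ items) →
      p.Exec ((R.set X (enc i ++ is.flatMap enc)).set Y o)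
        ((R.set X (is.flatMap enc)).set Y (g o i)) B)
    (h : R.get X = items.flatMap enc) :
    (loop X X (onFst Option.isSome) p).Exec R
      ((R.set X []).set Y (items.foldl g (R.get Y))) (items.length * (B + 1) + 1) :=
  exec_loop_fold hXY enc id g (fun _ => True) (fun _ _ _ _ => trivial) henc B
    (fun i is b hi _ => hbody i is b hi) h trivial rfl

end Prog

/-! ### Lengths of concatenated encodings -/

theorem length_le_length_flatMap {ι α : Type} {f : ι → List α} {l : List ι} {i : ι} (hi : i ∈ l) :
    (f i).length ≤ (l.flatMap f).length := by
  induction l with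
  | nil => cases hi
  | cons j l ih =>
    rw [List.flatMap_cons, List.length_append]
    rcases List.mem_cons.1 hi with rfl | hi
    · omega
    · have := ih hi
      omega

theorem length_le_length_flatMap_of_ne_nil {ι α : Type} {f : ι → List α} {l : List ι}
    (h : ∀ i ∈ l, f i ≠ []) : l.length ≤ (l.flatMap f).length := by
  induction l with
  | nil => simp
  | cons j l ih =>
    rw [List.flatMap_cons, List.length_append, List.length_cons]
    have h1 := ih fun i hi => h i (.tail _ hi)
    have h2 := List.length_pos_iff.2 (h j (.head _))
    omega

theorem isToken_encodeLiteral (l : Literal) : IsToken (encodeLiteral l) := by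
  refine ⟨_, _, rfl, ?_, ?_⟩
  · cases l.2 <;> rfl
  · intro a ha
    obtain ⟨b, -, rfl⟩ := List.mem_map.1 ha
    rfl

namespace Prog

/-! ### Removing literals from clauses -/

/-- Move a literal from the stack `f` to the output unless it equals the literal on `L`. -/
def emitUnlessEq (L : Reg) : Prog Reg :=
  (splitToken .t .f .w).seq ((copy .t .w .x).seq ((copy .t L .y).seq
    ((compare .x .y .flag).seq (ite .flag .flag (onFst Option.isSome)
      ((pop .flag).seq (clear .w)) (moveAll .w .out)))))

/-- Emit the literals of the clause on `C` that differ from the literal on `L`. -/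
def emitRemove (C L : Reg) : Prog Reg :=
  (copy .t C .f).seq (loop .f .f (onFst Option.isSome) (emitUnlessEq L))

theorem exec_emitUnlessEq {R : Regs} {L : Reg} (hL : L = .l ∨ L = .nl)
    (hw : R.w = []) (hx : R.x = []) (hy : R.y = []) (ht : R.t = []) (hflag : R.flag = [])
    {w r : List InSym} (hf : R.f = w ++ r) (htok : IsToken w) (hr : isBit r.head? = false) :
    (emitUnlessEq L).Exec R
      { R with f := r, out := (if w = R.get L then [] else w).reverse ++ R.out }
      (21 * w.length + 12 * (R.get L).length + 13) := by
  obtain ⟨inp, out, phi, a, l, nl, b, c, e, d, f, w, x, y, t, flag⟩ := R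
  dsimp only at hw hx hy ht hflag hf
  subst hw hx hy ht hflag hf
  have h1 : (copy .t L .y).Exec
      ⟨inp, out, phi, a, l, nl, b, c, e, d, r, w, w, [], [], []⟩ _ _ :=
    exec_copy (by rcases hL with rfl | rfl <;> decide) (by decide)
      (by rcases hL with rfl | rfl <;> decide) rfl
  by_cases heq : w = Regs.get ⟨inp, out, phi, a, l, nl, b, c, e, d, w ++ r, [], [], [], [], []⟩ L
  · refine ((exec_splitToken (by decide) (by decide) (by decide) rfl htok hr rfl).seq
      (((exec_copy (by decide) (by decide) (by decide) rfl).congr ?_ le_rfl).seq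
      (h1.seq ((exec_compare (by decide) (by decide) (by decide)).seq
      (Exec.ite_true ?_ ((exec_pop .flag).seq (exec_clear .w))))))).congr ?_ ?_
    all_goals rcases hL with rfl | rfl
    all_goals simp at heq
    all_goals simp [onFst, heq]
    all_goals omega
  · refine ((exec_splitToken (by decide) (by decide) (by decide) rfl htok hr rfl).seq
      (((exec_copy (by decide) (by decide) (by decide) rfl).congr ?_ le_rfl).seq
      (h1.seq ((exec_compare (by decide) (by decide) (by decide)).seq
      (Exec.ite_false ?_ (exec_moveAll (by decide))))))).congr ?_ ?_
    all_goals rcases hL with rfl | rfl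
    all_goals simp at heq
    all_goals simp [onFst, heq]
    all_goals omega

theorem flatMap_removeLiteral (u : List InSym) (D : Clause) :
    (CNF.removeLiteral u D).flatMap encodeLiteral =
      D.flatMap fun l => if encodeLiteral l = u then [] else encodeLiteral l := by
  unfold CNF.removeLiteral
  induction D with
  | nil => rfl
  | cons l D ih =>
    by_cases hl : encodeLiteral l = u <;> simp [hl, ← ih]

theorem length_le_of_flatMap_encodeLiteral {D : Clause} {N : ℕ}
    (hD : (D.flatMap encodeLiteral).length ≤ N) :
    D.length ≤ N ∧ ∀ l ∈ D, (encodeLiteral l).length ≤ N :=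
  ⟨(length_le_length_flatMap_of_ne_nil fun l _ => (isToken_encodeLiteral l).ne_nil).trans hD,
    fun _ hl => (length_le_length_flatMap hl).trans hD⟩

theorem exec_emitRemove {R : Regs} {C L : Reg} (hC : C = .c ∨ C = .d) (hL : L = .l ∨ L = .nl)
    (hf : R.f = []) (hw : R.w = []) (hx : R.x = []) (hy : R.y = []) (ht : R.t = [])
    (hflag : R.flag = []) {D : Clause} (hD : R.get C = D.flatMap encodeLiteral) {N : ℕ}
    (hCN : (R.get C).length ≤ N) (hLN : (R.get L).length ≤ N) :
    (emitRemove C L).Exec R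
      { R with out := ((CNF.removeLiteral (R.get L) D).flatMap encodeLiteral).reverse ++ R.out }
      (40 * (N + 1) ^ 2) := by
  obtain ⟨hlen, hlit⟩ := length_le_of_flatMap_encodeLiteral (hD ▸ hCN)
  have hget : ∀ u o, Regs.get { R with f := u, out := o } L = R.get L := by
    rcases hL with rfl | rfl <;> exact fun _ _ => rfl
  have hloop := exec_loop_emit (R := { R with f := R.get C }) (X := .f) (Y := .out) (by decide)
    (p := emitUnlessEq L) encodeLiteral
    (fun o l => (if encodeLiteral l = R.get L then [] else encodeLiteral l).reverse ++ o)
    (items := D) (fun l _ => (isToken_encodeLiteral l).ne_nil) (33 * N + 13)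
    (fun l ls o hls => by
      have := exec_emitUnlessEq
        (R := { R with f := encodeLiteral l ++ ls.flatMap encodeLiteral, out := o }) hL hw hx hy ht hflag rfl (isToken_encodeLiteral l)
        (isBit_head_flatMap fun i _ => isToken_encodeLiteral i)
      rw [hget] at this
      have hl := hlit l (hls l (.head _))
      exact this.congr rfl (by omega)) hD
  rw [foldl_emit fun l => if encodeLiteral l = R.get L then [] else encodeLiteral l,
    ← flatMap_removeLiteral] at hloop
  have hcopy := exec_copy (R := R) (X := C) (Y := .f) (by rcases hC with rfl | rfl <;> decide)
    (by decide) (by rcases hC with rfl | rfl <;> decide) ht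
  refine ((hcopy.congr ?_ le_rfl).seq hloop).congr ?_ ?_
  · simp [hf]
  · simp [← hf]
  · have := Nat.mul_le_mul_right (33 * N + 13 + 1) hlen
    ring_nf at this ⊢
    omega

/-! ### Emitting all resolvents -/

/-- Move a clause from the stack `e` and emit its resolvent with the clause on `c`. -/
def emitResolvent : Prog Reg :=
  (splitUntil .endClause .t .e .d).seq ((emitRemove .c .l).seq ((emitRemove .d .nl).seq
    ((push .out .endClause).seq (clear .d))))

/-- Move a clause from the stack `b` and emit its resolvents with all clauses. -/
def emitResolventsOfClause : Prog Reg :=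
  (splitUntil .endClause .t .b .c).seq ((copy .t .phi .e).seq
    ((loop .e .e (onFst Option.isSome) emitResolvent).seq (clear .c)))

/-- Move a literal from the stack `a` and emit all resolvents on this literal. -/
def emitResolventsOn : Prog Reg :=
  (splitToken .t .a .l).seq ((copy .t .l .nl).seq ((move .nl .x flipSign).seq
    ((move .x .nl id).seq ((copy .t .phi .b).seq
      ((loop .b .b (onFst Option.isSome) emitResolventsOfClause).seq
        ((clear .nl).seq (clear .l)))))))

/-- Add all resolvents to the formula on `phi`. -/
def resolveProg : Prog Reg :=
  (copy .t .phi .a).seq ((loop .a .a (onFst Option.isSome) emitResolventsOn).seq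
    (moveAll .out .phi))

theorem endClause_notMem_flatMap (D : Clause) : .endClause ∉ D.flatMap encodeLiteral := by
  intro h
  obtain ⟨l, -, hl⟩ := List.mem_flatMap.1 h
  rcases List.mem_cons.1 hl with hl | hl
  · cases h2 : l.2 <;> simp [h2] at hl
  · obtain ⟨b, -, hb⟩ := List.mem_map.1 hl
    cases hb

theorem exec_emitResolvent {inp out phi a l nl b r : List InSym} {C D : Clause} {N : ℕ}
    (hC : (C.flatMap encodeLiteral).length ≤ N) (hD : (encodeClause D).length ≤ N)
    (hl : l.length ≤ N) (hnl : nl.length ≤ N) :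
    emitResolvent.Exec
      ⟨inp, out, phi, a, l, nl, b, C.flatMap encodeLiteral, encodeClause D ++ r, [], [], [], [], [],
        [], []⟩
      ⟨inp, (encodeClause (CNF.removeLiteral l C ++ CNF.removeLiteral nl D)).reverse ++ out, phi, a,
        l, nl, b, C.flatMap encodeLiteral, r, [], [], [], [], [], [], []⟩
      (90 * (N + 1) ^ 2) := by
  have hD' : (D.flatMap encodeLiteral).length + 1 ≤ N := by simpa [encodeClause] using hD
  refine ((exec_splitUntil (by decide) (by decide) (by decide) rfl (endClause_notMem_flatMap D)
    (r := r) (by simp [encodeClause])).seq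
    ((exec_emitRemove (.inl rfl) (.inl rfl) rfl rfl rfl rfl rfl rfl (D := C) rfl hC hl).seq
    ((exec_emitRemove (.inr rfl) (.inr rfl) rfl rfl rfl rfl rfl rfl (D := D) (N := N) ?_ ?_ ?_).seq
    ((exec_push _ _).seq (exec_clear _))))).congr ?_ ?_
  · simp
  · simp only [Regs.get, Regs.set, List.append_nil]
    omega
  · exact hnl
  · simp [encodeClause]
  · simp only [Regs.get, Regs.set, List.append_nil]
    ring_nf
    omega

theorem length_encodeClause (C : Clause) :
    (encodeClause C).length = (C.flatMap encodeLiteral).length + 1 := by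
  simp [encodeClause]

theorem encodeClause_ne_nil (C : Clause) : encodeClause C ≠ [] := by
  simp [encodeClause]

theorem length_le_of_flatMap_encodeClause {φ : CNF} {N : ℕ}
    (hφ : (φ.flatMap encodeClause).length ≤ N) :
    φ.length ≤ N ∧ ∀ C ∈ φ, (encodeClause C).length ≤ N :=
  ⟨(length_le_length_flatMap_of_ne_nil fun C _ => encodeClause_ne_nil C).trans hφ,
    fun _ hC => (length_le_length_flatMap hC).trans hφ⟩

theorem exec_emitResolventsOfClause {inp out a l nl r : List InSym} {φ : CNF} {C : Clause}
    {N : ℕ} (hφ : (φ.flatMap encodeClause).length ≤ N) (hC : (encodeClause C).length ≤ N)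
    (hl : l.length ≤ N) (hnl : nl.length ≤ N) :
    emitResolventsOfClause.Exec
      ⟨inp, out, φ.flatMap encodeClause, a, l, nl, encodeClause C ++ r, [], [], [], [], [], [], [],
        [], []⟩
      ⟨inp, (φ.flatMap fun D =>
          encodeClause (CNF.removeLiteral l C ++ CNF.removeLiteral nl D)).reverse ++ out,
        φ.flatMap encodeClause, a, l, nl, r, [], [], [], [], [], [], [], [], []⟩
      (110 * (N + 1) ^ 3) := by
  obtain ⟨hlen, hcl⟩ := length_le_of_flatMap_encodeClause hφ
  rw [length_encodeClause] at hC
  have hloop := exec_loop_emit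
    (R := ⟨inp, out, φ.flatMap encodeClause, a, l, nl, r, C.flatMap encodeLiteral,
      φ.flatMap encodeClause, [], [], [], [], [], [], []⟩) (X := .e) (Y := .out) (by decide)
    (p := emitResolvent) encodeClause
    (fun o D => (encodeClause (CNF.removeLiteral l C ++ CNF.removeLiteral nl D)).reverse ++ o)
    (items := φ) (fun D _ => encodeClause_ne_nil D) (90 * (N + 1) ^ 2)
    (fun D Ds o hDs =>
      exec_emitResolvent (by omega) (hcl D (hDs D (.head _))) hl hnl) rfl
  rw [foldl_emit fun D => encodeClause (CNF.removeLiteral l C ++ CNF.removeLiteral nl D)] at hloop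
  refine (((exec_splitUntil (by decide) (by decide) (by decide) rfl (endClause_notMem_flatMap C)
    (r := r) (by simp [encodeClause])).seq
    (((exec_copy (by decide) (by decide) (by decide) rfl).congr ?_ le_rfl).seq
      (hloop.seq (exec_clear _))))).congr ?_ ?_
  · simp
  · simp
  · have := Nat.mul_le_mul_right (90 * (N + 1) ^ 2 + 1) hlen
    simp only [Regs.get, Regs.set]
    ring_nf at this ⊢
    omega

theorem isToken_of_mem_tokens {φ : CNF} {w : List InSym} (hw : w ∈ φ.tokens) : IsToken w := by
  obtain ⟨C, -, hw⟩ := List.mem_flatMap.1 hw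
  rcases List.mem_append.1 hw with hw | hw
  · obtain ⟨l, -, rfl⟩ := List.mem_map.1 hw
    exact isToken_encodeLiteral l
  · rw [List.mem_singleton.1 hw]
    exact ⟨_, [], rfl, rfl, by simp⟩

/-- The encoding of `φ` is exactly the concatenation of its tokens. By treating end markers as
literals to resolve on, the outer loop of the program can consume a plain copy of the formula. -/
theorem flatten_tokens (φ : CNF) : φ.tokens.flatMap id = φ.flatMap encodeClause := by
  unfold CNF.tokens
  rw [List.flatMap_assoc]
  congr 1
  funext C
  simp [encodeClause, List.flatMap_def]

theorem exec_emitResolventsOn {inp out r w : List InSym} {φ : CNF}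
    {N : ℕ} (hφ : (φ.flatMap encodeClause).length ≤ N) (hw : IsToken w)
    (hr : isBit r.head? = false) (hwN : w.length ≤ N) :
    emitResolventsOn.Exec
      ⟨inp, out, φ.flatMap encodeClause, w ++ r, [], [], [], [], [], [], [], [], [], [], [], []⟩
      ⟨inp, (φ.flatMap fun C => φ.flatMap fun D => encodeClause
          (CNF.removeLiteral w C ++ CNF.removeLiteral (flipHead w) D)).reverse ++ out,
        φ.flatMap encodeClause, r, [], [], [], [], [], [], [], [], [], [], [], []⟩
      (150 * (N + 1) ^ 4) := by
  obtain ⟨hlen, hcl⟩ := length_le_of_flatMap_encodeClause hφ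
  have hflip : (flipHead w).length ≤ N := by simpa [flipHead] using hwN
  have hloop := exec_loop_emit
    (R := ⟨inp, out, φ.flatMap encodeClause, r, w, flipHead w, φ.flatMap encodeClause, [], [],
      [], [], [], [], [], [], []⟩) (X := .b) (Y := .out) (by decide)
    (p := emitResolventsOfClause) encodeClause
    (fun o C => (φ.flatMap fun D => encodeClause
      (CNF.removeLiteral w C ++ CNF.removeLiteral (flipHead w) D)).reverse ++ o)
    (items := φ) (fun D _ => encodeClause_ne_nil D) (110 * (N + 1) ^ 3)
    (fun C Cs o hCs =>
      exec_emitResolventsOfClause hφ (hcl C (hCs C (.head _))) hwN hflip) rfl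
  rw [foldl_emit fun C => φ.flatMap fun D => encodeClause
      (CNF.removeLiteral w C ++ CNF.removeLiteral (flipHead w) D)] at hloop
  have hw' := hw
  obtain ⟨h, u, rfl, -, -⟩ := hw'
  refine ((exec_splitToken (by decide) (by decide) (by decide) rfl hw hr rfl).seq
    ((exec_copy (by decide) (by decide) (by decide) rfl).seq
    -- The head of the copy of `w` travels to `x`, changing its sign, and back, so that `nl` holds
    -- `flipHead w`.
    ((exec_move (by decide) flipSign (a := h) (r := u) (by simp)).seq
    ((exec_move (by decide) id (a := flipSign h) (r := []) (by simp)).seq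
    (((exec_copy (by decide) (by decide) (by decide) rfl).congr ?_ le_rfl).seq
    (hloop.seq ((exec_clear _).seq (exec_clear _)))))))).congr ?_ ?_
  · simp [flipHead]
  · simp
  · have := Nat.mul_le_mul_right (110 * (N + 1) ^ 3 + 1) hlen
    have h1 : (flipHead (h :: u)).length = u.length + 1 := by simp [flipHead]
    simp only [Regs.get, Regs.set, List.length_append, List.length_cons, List.length_nil] at hwN ⊢
    rw [h1]
    ring_nf at this ⊢
    omega

theorem flatMap_resolvents (φ : CNF) : φ.resolvents.flatMap encodeClause =
    φ.tokens.flatMap fun w => φ.flatMap fun C => φ.flatMap fun D => encodeClause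
      (CNF.removeLiteral w C ++ CNF.removeLiteral (flipHead w) D) := by
  simp [CNF.resolvents, List.flatMap_assoc, List.flatMap_map]

theorem length_flatMap_le {ι α : Type} {f : ι → List α} {l : List ι} {B : ℕ}
    (h : ∀ i ∈ l, (f i).length ≤ B) : (l.flatMap f).length ≤ l.length * B := by
  induction l with
  | nil => simp
  | cons j l ih =>
    rw [List.flatMap_cons, List.length_append, List.length_cons]
    have h1 := ih fun i hi => h i (.tail _ hi)
    have h2 := h j (.head _)
    rw [Nat.succ_mul]
    omega

theorem length_removeLiteral_le (u : List InSym) (C : Clause) :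
    ((CNF.removeLiteral u C).flatMap encodeLiteral).length ≤
      (C.flatMap encodeLiteral).length := by
  unfold CNF.removeLiteral
  induction C with
  | nil => simp
  | cons l C ih =>
    simp only [List.filter_cons, List.flatMap_cons, List.length_append]
    split_ifs
    · simpa using ih
    · omega

theorem length_tokens_le {φ : CNF} {N : ℕ} (hφ : (φ.flatMap encodeClause).length ≤ N) :
    φ.tokens.length ≤ N ∧ ∀ w ∈ φ.tokens, w.length ≤ N := by
  rw [← flatten_tokens] at hφ
  exact ⟨(length_le_length_flatMap_of_ne_nil fun w hw => (isToken_of_mem_tokens hw).ne_nil).trans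
    hφ, fun w hw => (length_le_length_flatMap (f := id) hw).trans hφ⟩

/-- There are at most `N` choices each for the token and the two clauses, and a resolvent has length
at most `2 * N`. -/
theorem length_resolvents_le {φ : CNF} {N : ℕ} (hφ : (φ.flatMap encodeClause).length ≤ N) :
    (φ.resolvents.flatMap encodeClause).length ≤ N * (N * (N * (2 * N))) := by
  obtain ⟨hlen, hcl⟩ := length_le_of_flatMap_encodeClause hφ
  rw [flatMap_resolvents]
  refine (length_flatMap_le fun w _ => (length_flatMap_le fun C hC =>
    (length_flatMap_le fun D hD => ?_).trans (Nat.mul_le_mul_right (2 * N) hlen)).trans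
    (Nat.mul_le_mul_right _ hlen)).trans (Nat.mul_le_mul_right _ (length_tokens_le hφ).1)
  have h1 := hcl C hC
  have h2 := hcl D hD
  have h3 := length_removeLiteral_le w C
  have h4 := length_removeLiteral_le (flipHead w) D
  rw [length_encodeClause] at h1 h2 ⊢
  rw [List.flatMap_append, List.length_append]
  omega

/-- Moving `out` to `phi` puts the resolvents in the right order on top of the old formula, which is
why `CNF.resolve` has the resolvents in front. -/
theorem exec_resolveProg {inp : List InSym} {φ : CNF} {N : ℕ}
    (hφ : (φ.flatMap encodeClause).length ≤ N) :
    resolveProg.Exec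
      ⟨inp, [], φ.flatMap encodeClause, [], [], [], [], [], [], [], [], [], [], [], [], []⟩
      ⟨inp, [], φ.resolve.flatMap encodeClause, [], [], [], [], [], [], [], [], [], [], [], [], []⟩
      (170 * (N + 1) ^ 5) := by
  obtain ⟨hlen, hcl⟩ := length_tokens_le hφ
  have hloop := exec_loop_emit
    (R := ⟨inp, [], φ.flatMap encodeClause, φ.flatMap encodeClause, [], [], [], [], [],
      [], [], [], [], [], [], []⟩) (X := .a) (Y := .out) (by decide)
    (p := emitResolventsOn) id
    (fun o w => (φ.flatMap fun C => φ.flatMap fun D => encodeClause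
      (CNF.removeLiteral w C ++ CNF.removeLiteral (flipHead w) D)).reverse ++ o)
    (items := φ.tokens) (fun w hw => (isToken_of_mem_tokens hw).ne_nil) (150 * (N + 1) ^ 4)
    (fun w ws o hws =>
      exec_emitResolventsOn hφ (isToken_of_mem_tokens (hws w (.head _)))
        (isBit_head_flatMap fun i hi => isToken_of_mem_tokens (hws i (.tail _ hi)))
        (hcl w (hws w (.head _)))) (flatten_tokens φ).symm
  rw [foldl_emit fun w => φ.flatMap fun C => φ.flatMap fun D => encodeClause
      (CNF.removeLiteral w C ++ CNF.removeLiteral (flipHead w) D), ← flatMap_resolvents] at hloop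
  refine (((exec_copy (by decide) (by decide) (by decide) rfl).congr ?_ le_rfl).seq
    (hloop.seq (exec_moveAll (by decide)))).congr ?_ ?_
  · simp
  · simp [CNF.resolve]
  · have h1 := Nat.mul_le_mul_right (150 * (N + 1) ^ 4 + 1) hlen
    have h2 := length_resolvents_le hφ
    simp only [Regs.get, Regs.set, List.length_append, List.length_reverse, List.length_nil]
    ring_nf at h1 h2 ⊢
    omega

end Prog

/-- The encoding of an element of a modulator. -/
def encodeModVar (v : ℕ) : List InSym := .modVar :: encodeVar v

theorem encodeModVar_injective : Function.Injective encodeModVar := fun _ _ h =>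
  encodeVar_injective (List.cons.inj h).2

theorem isToken_encodeModVar (v : ℕ) : IsToken (encodeModVar v) :=
  ⟨_, _, rfl, rfl, (isToken_encodeLiteral (v, true)).elim fun _ ⟨_, h, _, h'⟩ =>
    (List.cons.inj h).2 ▸ h'⟩

namespace Prog

/-! ### Membership in the list of variables on the stack `inp` -/

/-- Move a variable from the stack `e` and compare it with the variable on `w`. -/
def compareNext : Prog Reg :=
  (splitToken .t .e .y).seq ((copy .t .w .x).seq (compare .x .y .flag))

/-- Test whether the variable on `w` is in the list on `inp`. -/
def memProg : Prog Reg :=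
  (copy .t .inp .e).seq ((loop .e .e (onFst Option.isSome) compareNext).seq
    (ite .flag .flag (onFst Option.isSome) ((clear .flag).seq (push .flag .pos)) skip))

/-- Replace the literal on `w` by its variable, and test whether it is in the list on `inp`. -/
def memVarProg : Prog Reg := (pop .w).seq ((push .w .modVar).seq memProg)

theorem exec_compareNext {inp out phi a l nl b c d f v w r fl : List InSym} (hv : IsToken v)
    (hr : isBit r.head? = false) :
    compareNext.Exec ⟨inp, out, phi, a, l, nl, b, c, v ++ r, d, f, w, [], [], [], fl⟩
      ⟨inp, out, phi, a, l, nl, b, c, r, d, f, w, [], [], [], if w = v then .pos :: fl else fl⟩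
      (11 * v.length + 12 * w.length + 8) := by
  refine ((exec_splitToken (by decide) (by decide) (by decide) rfl hv hr rfl).seq
    ((exec_copy (by decide) (by decide) (by decide) rfl).seq
      (exec_compare (by decide) (by decide) (by decide)))).congr ?_ ?_
  · simp
  · simp only [Regs.get, Regs.set, List.append_nil]
    omega

/-- The flag stack collects one mark per match, so it stays empty exactly when the variable is
absent. `memProg` afterwards reduces the marks to one. -/
theorem foldl_compare {M : List ℕ} {x : ℕ} {fl : List InSym} :
    (M.foldl (fun o v => if encodeModVar x = encodeModVar v then .pos :: o else o) fl) = [] ↔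
      fl = [] ∧ x ∉ M := by
  induction M generalizing fl with
  | nil => simp
  | cons v M ih =>
    rw [List.foldl_cons, ih]
    by_cases h : x = v
    · simp [h]
    · simp [h, encodeModVar_injective.eq_iff]

theorem length_foldl_compare {M : List ℕ} {x : ℕ} {fl : List InSym} :
    (M.foldl (fun o v => if encodeModVar x = encodeModVar v then .pos :: o else o) fl).length ≤
      fl.length + M.length := by
  induction M generalizing fl with
  | nil => simp
  | cons v M ih =>
    rw [List.foldl_cons]
    refine ih.trans ?_
    split_ifs <;> grind

theorem exec_memProg {out phi a l nl b c d f : List InSym} {M : List ℕ} {v N : ℕ}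
    (hM : (M.flatMap encodeModVar).length ≤ N) (hv : (encodeModVar v).length ≤ N) :
    memProg.Exec
      ⟨M.flatMap encodeModVar, out, phi, a, l, nl, b, c, [], d, f, encodeModVar v, [], [], [], []⟩
      ⟨M.flatMap encodeModVar, out, phi, a, l, nl, b, c, [], d, f, encodeModVar v, [], [], [],
        if v ∈ M then [.pos] else []⟩ (40 * (N + 1) ^ 2) := by
  have hlen : M.length ≤ N := (length_le_length_flatMap_of_ne_nil
    fun v _ => (isToken_encodeModVar v).ne_nil).trans hM
  have hloop := exec_loop_emit
    (R := ⟨M.flatMap encodeModVar, out, phi, a, l, nl, b, c, M.flatMap encodeModVar, d, f,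
      encodeModVar v, [], [], [], []⟩) (X := .e) (Y := .flag) (by decide)
    (p := compareNext) encodeModVar
    (fun o u => if encodeModVar v = encodeModVar u then .pos :: o else o)
    (items := M) (fun u _ => (isToken_encodeModVar u).ne_nil) (23 * N + 8)
    (fun u us o hus => by
      have hu := (length_le_length_flatMap (f := encodeModVar) (hus u (.head _))).trans hM
      exact (exec_compareNext (isToken_encodeModVar u)
        (isBit_head_flatMap fun i _ => isToken_encodeModVar i)).congr rfl (by
          show 11 * _ + 12 * (encodeModVar v).length + 8 ≤ _
          omega)) rfl
  have hfl := length_foldl_compare (M := M) (x := v) (fl := [])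
  have hmem := foldl_compare (M := M) (x := v) (fl := [])
  generalize hF : M.foldl _ _ = F at hloop
  have hF' : M.foldl (fun o u => if encodeModVar v = encodeModVar u then .pos :: o else o) [] = F :=
    hF
  rw [hF'] at hfl hmem
  have hite : (ite .flag .flag (onFst Option.isSome) ((clear .flag).seq (push .flag .pos))
      skip).Exec ⟨M.flatMap encodeModVar, out, phi, a, l, nl, b, c, [], d, f, encodeModVar v, [],
        [], [], F⟩
      ⟨M.flatMap encodeModVar, out, phi, a, l, nl, b, c, [], d, f, encodeModVar v, [], [], [],
        if v ∈ M then [.pos] else []⟩ (2 * N + 3) := by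
    by_cases hvM : v ∈ M
    · refine (Exec.ite_true ?_ ((exec_clear .flag).seq (exec_push .flag .pos))).congr ?_ ?_
      · cases F with
        | nil => simp [hvM] at hmem
        | cons _ _ => rfl
      · simp [hvM]
      · simp only [Regs.get]
        simp only [List.length_nil] at hfl
        omega
    · have : F = [] := hmem.2 ⟨rfl, hvM⟩
      subst this
      exact (Exec.ite_false rfl exec_skip).congr (by simp [hvM]) (by omega)
  refine (((exec_copy (by decide) (by decide) (by decide) rfl).congr ?_ le_rfl).seq
    ((hloop.congr ?_ le_rfl).seq hite)).congr rfl ?_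
  · simp
  · simp
  · have := Nat.mul_le_mul_right (23 * N + 8 + 1) hlen
    simp only [Regs.get]
    ring_nf at this ⊢
    omega

theorem exec_memVarProg {out phi a l nl b c d f : List InSym} {M : List ℕ} {u : Literal} {N : ℕ}
    (hM : (M.flatMap encodeModVar).length ≤ N) (hu : (encodeLiteral u).length ≤ N) :
    memVarProg.Exec
      ⟨M.flatMap encodeModVar, out, phi, a, l, nl, b, c, [], d, f, encodeLiteral u, [], [], [], []⟩
      ⟨M.flatMap encodeModVar, out, phi, a, l, nl, b, c, [], d, f, encodeModVar u.1, [], [], [],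
        if u.1 ∈ M then [.pos] else []⟩ (42 * (N + 1) ^ 2) := by
  -- The encodings of a literal and of an element of the modulator differ only in the first symbol.
  refine ((exec_pop .w).seq ((exec_push .w .modVar).seq
    (exec_memProg (v := u.1) hM hu))).congr rfl ?_
  ring_nf
  omega

/-! ### Selecting the clauses over a set of variables -/

/-- Move a literal from the stack `f`, and push a symbol on `d` if its variable is not in the list
on `inp`. -/
def checkLiteral : Prog Reg :=
  (splitToken .t .f .w).seq (memVarProg.seq
    ((ite .flag .flag (onFst Option.isSome) (pop .flag) (push .d .neg)).seq (clear .w)))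

/-- Move a clause from the stack `phi`, and emit it if its variables are in the list on `inp`. -/
def filterClause : Prog Reg :=
  (splitUntil .endClause .t .phi .c).seq ((copy .t .c .f).seq
    ((loop .f .f (onFst Option.isSome) checkLiteral).seq
      (ite .d .d (onFst Option.isSome) ((clear .d).seq (clear .c))
        ((moveAll .c .out).seq (push .out .endClause)))))

/-- Emit the formula that consists of the clauses on the stack `phi` whose variables are in the
list on `inp`. -/
def filterProg : Prog Reg :=
  (loop .phi .phi (onFst Option.isSome) filterClause).seq
    ((push .out .endFormula).seq (clear .inp))

theorem exec_checkLiteral {out phi a l nl b c d r : List InSym} {M : List ℕ} {u : Literal} {N : ℕ}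
    (hM : (M.flatMap encodeModVar).length ≤ N) (hu : (encodeLiteral u).length ≤ N)
    (hr : isBit r.head? = false) :
    checkLiteral.Exec
      ⟨M.flatMap encodeModVar, out, phi, a, l, nl, b, c, [], d, encodeLiteral u ++ r, [], [], [],
        [], []⟩
      ⟨M.flatMap encodeModVar, out, phi, a, l, nl, b, c, [], if u.1 ∈ M then d else .neg :: d, r,
        [], [], [], [], []⟩ (60 * (N + 1) ^ 2) := by
  have hite : (ite .flag .flag (onFst Option.isSome) (pop .flag) (push .d .neg)).Exec
      ⟨M.flatMap encodeModVar, out, phi, a, l, nl, b, c, [], d, r, encodeModVar u.1, [], [], [],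
        if u.1 ∈ M then [.pos] else []⟩
      ⟨M.flatMap encodeModVar, out, phi, a, l, nl, b, c, [], if u.1 ∈ M then d else .neg :: d, r,
        encodeModVar u.1, [], [], [], []⟩ 2 := by
    by_cases h : u.1 ∈ M
    · simp only [h, if_true]
      exact Exec.ite_true rfl (exec_pop .flag)
    · simp only [h, if_false]
      exact Exec.ite_false rfl (exec_push .d .neg)
  refine (((exec_splitToken (by decide) (by decide) (by decide) rfl (isToken_encodeLiteral u) hr
    rfl).congr ?_ le_rfl).seq ((exec_memVarProg hM hu).seq
      (hite.seq (exec_clear .w)))).congr ?_ ?_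
  · simp
  · simp
  · have : (encodeModVar u.1).length ≤ N := hu
    simp only [Regs.get]
    ring_nf
    omega

theorem foldl_check {M : List ℕ} {C : Clause} {d : List InSym} :
    C.foldl (fun d u => if u.1 ∈ M then d else .neg :: d) d = [] ↔
      d = [] ∧ ∀ u ∈ C, u.1 ∈ M := by
  induction C generalizing d with
  | nil => simp
  | cons u C ih =>
    rw [List.foldl_cons, ih]
    by_cases h : u.1 ∈ M <;> simp [h]

theorem length_foldl_check {M : List ℕ} {C : Clause} {d : List InSym} :
    (C.foldl (fun d u => if u.1 ∈ M then d else .neg :: d) d).length ≤ d.length + C.length := by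
  induction C generalizing d with
  | nil => simp
  | cons u C ih =>
    rw [List.foldl_cons]
    refine ih.trans ?_
    split_ifs <;> grind

theorem exec_filterClause {out a l nl b r : List InSym} {M : List ℕ} {C : Clause} {N : ℕ}
    (hM : (M.flatMap encodeModVar).length ≤ N) (hC : (encodeClause C).length ≤ N) :
    filterClause.Exec
      ⟨M.flatMap encodeModVar, out, encodeClause C ++ r, a, l, nl, b, [], [], [], [], [], [], [],
        [], []⟩
      ⟨M.flatMap encodeModVar, (if ∀ u ∈ C, u.1 ∈ M then encodeClause C else []).reverse ++ out, r,
        a, l, nl, b, [], [], [], [], [], [], [], [], []⟩ (90 * (N + 1) ^ 3) := by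
  rw [length_encodeClause] at hC
  obtain ⟨hlen, hlit⟩ := length_le_of_flatMap_encodeLiteral (D := C) (N := N) (by omega)
  have hloop := exec_loop_emit
    (R := ⟨M.flatMap encodeModVar, out, r, a, l, nl, b, C.flatMap encodeLiteral, [], [],
      C.flatMap encodeLiteral, [], [], [], [], []⟩) (X := .f) (Y := .d) (by decide)
    (p := checkLiteral) encodeLiteral (fun d u => if u.1 ∈ M then d else .neg :: d)
    (items := C) (fun u _ => (isToken_encodeLiteral u).ne_nil) (60 * (N + 1) ^ 2)
    (fun u us o hus => exec_checkLiteral hM (hlit u (hus u (.head _)))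
      (isBit_head_flatMap fun i _ => isToken_encodeLiteral i)) rfl
  have hfl := length_foldl_check (M := M) (C := C) (d := [])
  have hmem := foldl_check (M := M) (C := C) (d := [])
  generalize hF : C.foldl _ _ = F at hloop
  have hF' : C.foldl (fun d u => if u.1 ∈ M then d else .neg :: d) [] = F := hF
  rw [hF'] at hfl hmem
  rw [List.length_nil] at hfl
  have hite : (ite .d .d (onFst Option.isSome) ((clear .d).seq (clear .c))
        ((moveAll .c .out).seq (push .out .endClause))).Exec
      ⟨M.flatMap encodeModVar, out, r, a, l, nl, b, C.flatMap encodeLiteral, [], F, [], [], [], [],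
        [], []⟩
      ⟨M.flatMap encodeModVar, (if ∀ u ∈ C, u.1 ∈ M then encodeClause C else []).reverse ++ out, r,
        a, l, nl, b, [], [], [], [], [], [], [], [], []⟩ (4 * N + 3) := by
    by_cases h : ∀ u ∈ C, u.1 ∈ M
    · have : F = [] := hmem.2 ⟨rfl, h⟩
      subst this
      refine (Exec.ite_false rfl ((exec_moveAll (by decide)).seq
        (exec_push .out .endClause))).congr ?_ ?_
      · rw [if_pos h]
        simp [encodeClause]
      · simp only [Regs.get]
        omega
    · refine (Exec.ite_true ?_ ((exec_clear .d).seq (exec_clear .c))).congr ?_ ?_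
      · cases F with
        | nil => exact absurd (hmem.1 rfl).2 h
        | cons _ _ => rfl
      · rw [if_neg h]
        simp
      · simp only [Regs.get, Regs.set]
        omega
  refine ((exec_splitUntil (by decide) (by decide) (by decide) rfl (endClause_notMem_flatMap C)
    (r := r) (by simp [encodeClause])).seq
    (((exec_copy (by decide) (by decide) (by decide) rfl).congr ?_ le_rfl).seq
    ((hloop.congr ?_ le_rfl).seq hite))).congr rfl ?_
  · simp
  · simp
  · have := Nat.mul_le_mul_right (60 * (N + 1) ^ 2 + 1) hlen
    simp only [Regs.get, Regs.set, List.append_nil]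
    ring_nf at this ⊢
    omega

theorem exec_filterProg {M : List ℕ} {φ : CNF} {N : ℕ}
    (hM : (M.flatMap encodeModVar).length ≤ N) (hφ : (φ.flatMap encodeClause).length ≤ N) :
    filterProg.Exec
      ⟨M.flatMap encodeModVar, [], φ.flatMap encodeClause, [], [], [], [], [], [], [], [], [], [],
        [], [], []⟩
      ⟨[], (encodeCNF (φ.restrict M)).reverse, [], [], [], [], [], [], [], [], [], [], [], [], [],
        []⟩ (100 * (N + 1) ^ 4) := by
  obtain ⟨hlen, hcl⟩ := length_le_of_flatMap_encodeClause hφ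
  have hloop := exec_loop_emit
    (R := ⟨M.flatMap encodeModVar, [], φ.flatMap encodeClause, [], [], [], [], [], [], [], [], [],
      [], [], [], []⟩) (X := .phi) (Y := .out) (by decide)
    (p := filterClause) encodeClause
    (fun o C => (if ∀ u ∈ C, u.1 ∈ M then encodeClause C else []).reverse ++ o)
    (items := φ) (fun C _ => encodeClause_ne_nil C) (90 * (N + 1) ^ 3)
    (fun C Cs o hCs => exec_filterClause hM (hcl C (hCs C (.head _)))) rfl
  rw [foldl_emit fun C : Clause => if ∀ u ∈ C, u.1 ∈ M then encodeClause C else []] at hloop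
  have hrestrict : (φ.flatMap fun C : Clause => if ∀ u ∈ C, u.1 ∈ M then encodeClause C else []) =
      (φ.restrict M).flatMap encodeClause := by
    clear hloop hφ hlen hcl
    unfold CNF.restrict
    induction φ with
    | nil => rfl
    | cons C φ ih =>
      rw [List.flatMap_cons, ih, List.filter_cons]
      by_cases h : ∀ u ∈ C, u.1 ∈ M
      · simp only [if_pos h, decide_eq_true h, List.flatMap_cons, if_true]
      · simp only [if_neg h, decide_eq_false h]
        rfl
  rw [hrestrict] at hloop
  refine (hloop.seq ((exec_push .out .endFormula).seq (exec_clear .inp))).congr ?_ ?_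
  · simp [encodeCNF]
  · have := Nat.mul_le_mul_right (90 * (N + 1) ^ 3 + 1) hlen
    simp only [Regs.get, Regs.set]
    ring_nf at this ⊢
    omega

end Prog

/-! ### The size of encodings -/

theorem mem_vars {φ : CNF} {v : ℕ} : v ∈ φ.vars ↔ ∃ l ∈ φ.flatten, l.1 = v := by
  simp only [CNF.vars, List.mem_toFinset, List.mem_map]

theorem length_flatMap_le_of_sublist {ι α : Type} {f : ι → List α} {l l' : List ι}
    (h : l.Sublist l') : (l.flatMap f).length ≤ (l'.flatMap f).length := by
  induction h with
  | slnil => rfl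
  | cons _ _ ih => rw [List.flatMap_cons, List.length_append]; omega
  | cons_cons _ _ ih =>
    rw [List.flatMap_cons, List.length_append, List.flatMap_cons, List.length_append]
    omega

theorem size_eq (φ : CNF) : φ.size = (φ.flatMap encodeClause).length + 1 := by
  simp [CNF.size, encodeCNF]

/-- The time may depend polynomially only on `|φ|`, while the input also contains `M`. Without
repetitions, `M` is a permutation of a sublist of the occurrences of variables in `φ`, and each
occurrence is written there with the same number of symbols. -/
theorem length_flatMap_encodeModVar_le {φ : CNF} {M : List ℕ} (hM : M.Nodup)
    (h : ∀ v ∈ M, v ∈ φ.vars) :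
    (M.flatMap encodeModVar).length ≤ (φ.flatMap encodeClause).length := by
  have hsub : M ⊆ φ.flatten.map Prod.fst := fun v hv => by
    obtain ⟨l, hl, rfl⟩ := mem_vars.1 (h v hv)
    exact List.mem_map_of_mem hl
  have h1 : (M.flatMap encodeModVar).length ≤
      ((φ.flatten.map Prod.fst).flatMap encodeModVar).length := by
    obtain ⟨M', hperm, hsubl⟩ := List.subperm_of_subset hM hsub
    rw [← (hperm.flatMap_right encodeModVar).length_eq]
    exact length_flatMap_le_of_sublist hsubl
  refine h1.trans ?_
  clear h1 hsub h
  induction φ with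
  | nil => simp
  | cons C φ ih =>
    simp only [List.flatten_cons, List.map_append, List.flatMap_append, List.length_append,
      List.flatMap_cons]
    refine Nat.add_le_add ?_ ih
    rw [Prog.length_encodeClause]
    clear ih
    induction C with
    | nil => simp
    | cons l C ih =>
      simp only [List.map_cons, List.flatMap_cons, List.length_append]
      have : (encodeModVar l.1).length = (encodeLiteral l).length := rfl
      omega

theorem encodeCNFWithSet_eq (φ : CNF) (M : List ℕ) : encodeCNFWithSet (φ, M) =
    φ.flatMap encodeClause ++ .endFormula :: M.flatMap encodeModVar := by
  simp [encodeCNFWithSet, encodeCNF]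
  rfl

theorem endFormula_notMem_flatMap (φ : CNF) : .endFormula ∉ φ.flatMap encodeClause := by
  intro h
  obtain ⟨C, -, hC⟩ := List.mem_flatMap.1 h
  rcases List.mem_append.1 hC with hC | hC
  · obtain ⟨l, -, hl⟩ := List.mem_flatMap.1 hC
    rcases List.mem_cons.1 hl with hl | hl
    · cases h2 : l.2 <;> simp [h2] at hl
    · obtain ⟨b, -, hb⟩ := List.mem_map.1 hl
      cases hb
  · simp at hC

/-- The variables of a formula, without repetitions. -/
def CNF.varList (φ : CNF) : List ℕ :=
  φ.foldl (fun M C => C.foldl (fun M l => if l.1 ∈ M then M else l.1 :: M) M) []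

/-- The list `M` has no repetitions and consists of variables of `φ`. -/
def IsVarList (φ : CNF) (M : List ℕ) : Prop := M.Nodup ∧ ∀ v ∈ M, v ∈ φ.vars

theorem IsVarList.insert {φ : CNF} {M : List ℕ} (h : IsVarList φ M) {C : Clause} (hC : C ∈ φ)
    {l : Literal} (hl : l ∈ C) : IsVarList φ (if l.1 ∈ M then M else l.1 :: M) := by
  split_ifs with hlM
  · exact h
  · refine ⟨List.nodup_cons.2 ⟨hlM, h.1⟩, fun v hv => ?_⟩
    rcases List.mem_cons.1 hv with rfl | hv
    · exact mem_vars.2 ⟨l, List.mem_flatten.2 ⟨C, hC, hl⟩, rfl⟩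
    · exact h.2 v hv

theorem mem_foldl_insert {C : List Literal} {M : List ℕ} {v : ℕ} :
    v ∈ C.foldl (fun M l => if l.1 ∈ M then M else l.1 :: M) M ↔ v ∈ M ∨ ∃ l ∈ C, l.1 = v := by
  induction C generalizing M with
  | nil => simp
  | cons l C ih =>
    rw [List.foldl_cons, ih]
    split_ifs with h
    · simp only [List.mem_cons, exists_eq_or_imp]
      refine ⟨fun h => by tauto, ?_⟩
      rintro (h' | rfl | h')
      · exact .inl h'
      · exact .inl h
      · exact .inr h'
    · simp only [List.mem_cons, exists_eq_or_imp, eq_comm (a := v)]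
      tauto

theorem IsVarList.foldl {φ : CNF} {M : List ℕ} (h : IsVarList φ M) {C : Clause} (hC : C ∈ φ) :
    IsVarList φ (C.foldl (fun M l => if l.1 ∈ M then M else l.1 :: M) M) :=
  List.foldlRecOn C _ h fun _ hb _ hl => hb.insert hC hl

theorem isVarList_varList (φ : CNF) : IsVarList φ φ.varList :=
  List.foldlRecOn φ _ (⟨.nil, by simp⟩ : IsVarList φ []) fun _ hb _ hC => hb.foldl hC

theorem mem_varList {φ : CNF} {v : ℕ} : v ∈ φ.varList ↔ v ∈ φ.vars := by
  rw [mem_vars, CNF.varList, ← List.foldl_flatten, mem_foldl_insert]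
  simp

theorem length_varList (φ : CNF) : φ.varList.length = φ.vars.card := by
  rw [← List.toFinset_card_of_nodup (isVarList_varList φ).1]
  congr 1
  ext v
  rw [List.mem_toFinset, mem_varList]

namespace Prog

open Polynomial

theorem single_eq_get (k : Reg) (u : List InSym) : single k u = (Regs.set
    ⟨[], [], [], [], [], [], [], [], [], [], [], [], [], [], [], []⟩ k u).get := by
  rw [← Regs.update_get, single]
  congr 1
  funext j
  cases j <;> rfl

/-! ### Reducing a formula to a modulator -/

/-- Several rounds of resolution. -/
def resolveIter : ℕ → Prog Reg
  | 0 => skip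
  | c + 1 => (resolveIter c).seq resolveProg

/-- Split the input into a formula on `phi` and a list of variables on `inp`. -/
def parseProg : Prog Reg := splitUntil .endFormula .t .inp .phi

/-- Reduce the formula in the input to the modulator in the input. -/
def reduceProg (c : ℕ) : Prog Reg := parseProg.seq ((resolveIter c).seq filterProg)

/-- One polynomial bounds both the time and the length of the result. It depends on `c`, which is
fixed, but not on the formula. -/
theorem exec_resolveIter (c : ℕ) : ∃ P : ℕ[X], ∀ (φ : CNF) (inp : List InSym) (N : ℕ),
    (φ.flatMap encodeClause).length ≤ N →
    ((CNF.resolve^[c] φ).flatMap encodeClause).length ≤ P.eval N ∧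
    (resolveIter c).Exec
      ⟨inp, [], φ.flatMap encodeClause, [], [], [], [], [], [], [], [], [], [], [], [], []⟩
      ⟨inp, [], (CNF.resolve^[c] φ).flatMap encodeClause, [], [], [], [], [], [], [], [], [], [],
        [], [], []⟩ (P.eval N) := by
  induction c with
  | zero => exact ⟨X + 1, fun φ inp N h => ⟨by simpa using h.trans (by omega),
      exec_skip.congr rfl (by simp)⟩⟩
  | succ c ih =>
    obtain ⟨P, hP⟩ := ih
    -- The time for one more round, on a formula of length at most `P`; it also dominates the new
    -- length `2 * P ^ 4 + P`.
    refine ⟨P + 170 * (P + 1) ^ 5, fun φ inp N h => ?_⟩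
    obtain ⟨h1, h2⟩ := hP φ inp N h
    simp only [Function.iterate_succ_apply', eval_add, eval_mul, eval_pow, eval_one, eval_ofNat]
    refine ⟨?_, h2.seq (exec_resolveProg h1)⟩
    rw [CNF.resolve, List.flatMap_append, List.length_append]
    have h3 := length_resolvents_le h1
    generalize P.eval N = n at h1 h3
    ring_nf at h3 ⊢
    omega

theorem exec_reduceProg (c : ℕ) : ∃ P : ℕ[X], ∀ (φ : CNF) (M : List ℕ), IsVarList φ M →
    ((CNF.resolve^[c] φ).restrict M).size ≤ P.eval φ.size ∧
    (reduceProg c).Run (single .inp (encodeCNFWithSet (φ, M)))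
      (single .out (encodeCNF ((CNF.resolve^[c] φ).restrict M)).reverse) (P.eval φ.size) := by
  obtain ⟨P, hP⟩ := exec_resolveIter c
  -- The summands pay for parsing, resolution and filtering. In the last one, `P + X` bounds both
  -- the resolved formula and the list `M`.
  refine ⟨6 * X + 3 + (P + 100 * (P + X + 1) ^ 4), fun φ M hM => ?_⟩
  have hφ : (φ.flatMap encodeClause).length ≤ φ.size := by rw [size_eq]; omega
  obtain ⟨h1, h2⟩ := hP φ (M.flatMap encodeModVar) φ.size hφ
  have hMN := (length_flatMap_encodeModVar_le hM.1 hM.2).trans hφ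
  have hfilter := exec_filterProg (φ := CNF.resolve^[c] φ) (N := P.eval φ.size + φ.size)
    (hMN.trans (by omega)) (h1.trans (by omega))
  simp only [eval_add, eval_mul, eval_pow, eval_one, eval_ofNat, eval_X]
  constructor
  · rw [size_eq]
    have h3 : (((CNF.resolve^[c] φ).restrict M).flatMap encodeClause).length ≤
        ((CNF.resolve^[c] φ).flatMap encodeClause).length :=
      length_flatMap_le_of_sublist List.filter_sublist
    omega
  · have hparse := exec_splitUntil
      (R := ⟨encodeCNFWithSet (φ, M), [], [], [], [], [], [], [], [], [], [], [], [], [], [], []⟩)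
      (X := .inp) (C := .phi) (by decide) (by decide) (by decide) rfl
      (endFormula_notMem_flatMap φ) (r := M.flatMap encodeModVar) (encodeCNFWithSet_eq φ M)
    have h := ((hparse.congr (by simp) le_rfl).seq (h2.seq hfilter)).congr rfl
      (n₂ := 6 * φ.size + 3 + (P.eval φ.size + 100 * (P.eval φ.size + φ.size + 1) ^ 4)) (by omega)
    rw [single_eq_get, single_eq_get]
    exact h

/-! ### Listing the variables of a formula -/

/-- Move a literal from the stack `f`, and add its variable to the list on `inp`. -/
def insertVar : Prog Reg :=
  (splitToken .t .f .w).seq (memVarProg.seq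
    ((ite .flag .flag (onFst Option.isSome) (pop .flag) (copy .t .w .inp)).seq (clear .w)))

/-- Move a clause from the stack `phi`, and add its variables to the list on `inp`. -/
def insertVars : Prog Reg :=
  (splitUntil .endClause .t .phi .f).seq (loop .f .f (onFst Option.isSome) insertVar)

/-- Emit the formula in the input together with the list of its variables. -/
def varListProg : Prog Reg :=
  (copy .t .inp .c).seq ((moveAll .inp .out).seq ((splitUntil .endFormula .t .c .phi).seq
    ((loop .phi .phi (onFst Option.isSome) insertVars).seq (moveAll .inp .out))))

theorem exec_insertVar {out phi a l nl b c d r : List InSym} {M : List ℕ} {u : Literal} {N : ℕ}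
    (hM : (M.flatMap encodeModVar).length ≤ N) (hu : (encodeLiteral u).length ≤ N)
    (hr : isBit r.head? = false) :
    insertVar.Exec
      ⟨M.flatMap encodeModVar, out, phi, a, l, nl, b, c, [], d, encodeLiteral u ++ r, [], [], [],
        [], []⟩
      ⟨(if u.1 ∈ M then M else u.1 :: M).flatMap encodeModVar, out, phi, a, l, nl, b, c, [], d, r,
        [], [], [], [], []⟩ (60 * (N + 1) ^ 2) := by
  have hu' : (encodeModVar u.1).length ≤ N := hu
  have hite : (ite .flag .flag (onFst Option.isSome) (pop .flag) (copy .t .w .inp)).Exec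
      ⟨M.flatMap encodeModVar, out, phi, a, l, nl, b, c, [], d, r, encodeModVar u.1, [], [], [],
        if u.1 ∈ M then [.pos] else []⟩
      ⟨(if u.1 ∈ M then M else u.1 :: M).flatMap encodeModVar, out, phi, a, l, nl, b, c, [], d, r,
        encodeModVar u.1, [], [], [], []⟩ (7 * N + 3) := by
    by_cases h : u.1 ∈ M
    · simp only [h, if_true]
      exact (Exec.ite_true rfl (exec_pop .flag)).congr rfl (by omega)
    · simp only [h, if_false]
      refine (Exec.ite_false rfl
        (exec_copy (by decide) (by decide) (by decide) rfl)).congr (by simp) ?_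
      simp only [Regs.get]
      omega
  refine (((exec_splitToken (by decide) (by decide) (by decide) rfl (isToken_encodeLiteral u) hr
    rfl).congr ?_ le_rfl).seq ((exec_memVarProg hM hu).seq
      (hite.seq (exec_clear .w)))).congr ?_ ?_
  · simp
  · simp
  · simp only [Regs.get]
    ring_nf
    omega

theorem exec_insertVars {out a l nl b c r : List InSym} {φ : CNF} {C : Clause} (hC : C ∈ φ)
    {M : List ℕ} (hM : IsVarList φ M) {N : ℕ} (hφ : (φ.flatMap encodeClause).length ≤ N) :
    insertVars.Exec
      ⟨M.flatMap encodeModVar, out, encodeClause C ++ r, a, l, nl, b, c, [], [], [], [], [], [], [],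
        []⟩
      ⟨(C.foldl (fun M u => if u.1 ∈ M then M else u.1 :: M) M).flatMap encodeModVar, out, r, a, l,
        nl, b, c, [], [], [], [], [], [], [], []⟩ (90 * (N + 1) ^ 3) := by
  have hCN := (length_le_of_flatMap_encodeClause hφ).2 C hC
  rw [length_encodeClause] at hCN
  obtain ⟨hlen, hlit⟩ := length_le_of_flatMap_encodeLiteral (D := C) (N := N) (by omega)
  have hloop := exec_loop_fold
    (R := ⟨M.flatMap encodeModVar, out, r, a, l, nl, b, c, [], [], C.flatMap encodeLiteral, [], [],
      [], [], []⟩) (X := .f) (Y := .inp) (by decide) (p := insertVar) encodeLiteral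
    (fun M : List ℕ => M.flatMap encodeModVar) (fun M u => if u.1 ∈ M then M else u.1 :: M)
    (IsVarList φ) (items := C) (fun M u hu hM => hM.insert hC hu)
    (fun u _ => (isToken_encodeLiteral u).ne_nil) (60 * (N + 1) ^ 2)
    (fun u us M hus hM => exec_insertVar
      ((length_flatMap_encodeModVar_le hM.1 hM.2).trans hφ) (hlit u (hus u (.head _)))
      (isBit_head_flatMap fun i _ => isToken_encodeLiteral i)) rfl hM rfl
  refine (((exec_splitUntil (by decide) (by decide) (by decide) rfl (endClause_notMem_flatMap C)
    (r := r) (by simp [encodeClause])).congr ?_ le_rfl).seq hloop).congr rfl ?_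
  · simp
  · have := Nat.mul_le_mul_right (60 * (N + 1) ^ 2 + 1) hlen
    ring_nf at this ⊢
    omega

/-- The output repeats the input, so the formula is first copied to `c` and then moved to `out`.
This frees `inp` for the growing list of variables, which has no repetitions and therefore never
gets longer than the formula. -/
theorem run_varListProg (φ : CNF) :
    varListProg.Run (single .inp (encodeCNF φ))
      (single .out (encodeCNFWithSet (φ, φ.varList)).reverse) (120 * (φ.size + 1) ^ 4) := by
  have hsize := size_eq φ
  have hφ : (φ.flatMap encodeClause).length ≤ φ.size := by omega
  obtain ⟨hlen, -⟩ := length_le_of_flatMap_encodeClause hφ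
  have henc : (encodeCNF φ).length = φ.size := rfl
  have hloop := exec_loop_fold
    (R := ⟨[], (encodeCNF φ).reverse, φ.flatMap encodeClause, [], [], [], [], [], [], [], [], [],
      [], [], [], []⟩) (X := .phi) (Y := .inp) (by decide) (p := insertVars) encodeClause
    (fun M : List ℕ => M.flatMap encodeModVar)
    (fun M C => C.foldl (fun M u => if u.1 ∈ M then M else u.1 :: M) M)
    (IsVarList φ) (items := φ) (fun M C hC hM => hM.foldl hC)
    (fun C _ => encodeClause_ne_nil C) (90 * (φ.size + 1) ^ 3)
    (fun C Cs M hCs hM => exec_insertVars (hCs C (.head _)) hM hφ) rfl (b := [])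
    ⟨.nil, by simp⟩ rfl
  have hM := (length_flatMap_encodeModVar_le (isVarList_varList φ).1
    (isVarList_varList φ).2).trans hφ
  have h := ((exec_copy (R := ⟨encodeCNF φ, [], [], [], [], [], [], [], [], [], [], [], [], [], [],
      []⟩) (X := .inp) (Y := .c) (by decide) (by decide) (by decide) rfl).seq
    ((exec_moveAll (X := .inp) (Y := .out) (by decide)).seq
    (((exec_splitUntil (X := .c) (C := .phi) (by decide) (by decide) (by decide) rfl
      (endFormula_notMem_flatMap φ) (r := []) (by simp [encodeCNF])).congr (by simp) le_rfl).seq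
    (hloop.seq (exec_moveAll (X := .inp) (Y := .out) (by decide)))))).congr
      (R₂ := ⟨[], (encodeCNFWithSet (φ, φ.varList)).reverse, [], [], [], [], [], [], [], [], [], [],
        [], [], [], []⟩) (n₂ := 120 * (φ.size + 1) ^ 4)
    (by rw [encodeCNFWithSet_eq]; simp [CNF.varList, encodeCNF]) (by
      have := Nat.mul_le_mul_right (90 * (φ.size + 1) ^ 3 + 1) hlen
      change _ + (_ + (_ + (_ + (3 * (φ.varList.flatMap encodeModVar).length + 1)))) ≤ _
      simp only [Regs.get, Regs.set, henc]
      ring_nf at this ⊢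
      omega)
  rw [single_eq_get, single_eq_get]
  exact h

end Prog

/-! ### Time bounds -/

/-- Brings polynomial bounds into the form with a single constant `a`. The condition `1 ≤ n` allows
exponents to be raised; it holds for sizes because of the end marker. -/
theorem exists_eval_le (P : Polynomial ℕ) : ∃ a : ℕ, ∀ n : ℕ, 1 ≤ n → P.eval n ≤ a * n ^ a := by
  induction P using Polynomial.induction_on' with
  | add P Q hP hQ =>
    obtain ⟨a, ha⟩ := hP
    obtain ⟨b, hb⟩ := hQ
    refine ⟨a + b, fun n hn => ?_⟩
    rw [Polynomial.eval_add, Nat.add_mul]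
    exact Nat.add_le_add
      ((ha n hn).trans (Nat.mul_le_mul_left a (Nat.pow_le_pow_right hn (by omega))))
      ((hb n hn).trans (Nat.mul_le_mul_left b (Nat.pow_le_pow_right hn (by omega))))
  | monomial k c =>
    refine ⟨c + k, fun n hn => ?_⟩
    rw [Polynomial.eval_monomial]
    exact Nat.mul_le_mul (by omega) (Nat.pow_le_pow_right hn (by omega))

theorem SolvableInTime.mono {I : Type} {valid : I → Prop} {enc : I → List InSym} {yes : I → Prop}
    {T T' : I → ℝ} (h : SolvableInTime valid enc yes T) (hT : ∀ x, valid x → T x ≤ T' x) :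
    SolvableInTime valid enc yes T' := by
  obtain ⟨A, hA⟩ := h
  refine ⟨A, fun x hx => ?_⟩
  obtain ⟨t, ht, h⟩ := hA x hx
  exact ⟨t, ht.trans (hT x hx), h⟩

/-- The initial configuration has a label and the final one has none, so at least one step is made.
Together with an instance whose exponent is 1, this rules out `ε > 2`, for which the time bound
would be nonpositive. -/
theorem SolvableInTime.pos {I : Type} {valid : I → Prop} {enc : I → List InSym} {yes : I → Prop}
    {T : I → ℝ} (h : SolvableInTime valid enc yes T) {x : I} (hx : valid x) : 0 < T x := by
  obtain ⟨A, hA⟩ := h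
  obtain ⟨t, ht, ⟨⟨n, hn⟩, hle⟩⟩ := hA x hx
  refine lt_of_lt_of_le ?_ ht
  have hle' : n ≤ t := hle
  rcases Nat.eq_zero_or_pos n with rfl | hpos
  · have := congrArg (Option.map fun c : A.tm.Cfg => c.l) hn
    cases Option.some.inj this
  · exact_mod_cast hpos.trans_le hle'

/-- The condition `ε ≤ 2` keeps the base nonnegative, without which powers need not be monotone in
the base. -/
theorem KSatSolvable.mono {ε δ : ℝ} {k : ℕ} (h : KSatSolvable ε k) (hε : ε ≤ 2) (hδ : δ ≤ ε) :
    KSatSolvable δ k := by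
  obtain ⟨a, h⟩ := h
  refine ⟨a, h.mono fun φ _ => ?_⟩
  gcongr

theorem KSatModulatorSolvable.mono {ε δ : ℝ} {c k : ℕ} (h : KSatModulatorSolvable ε c k)
    (hε : ε ≤ 2) (hδ : δ ≤ ε) : KSatModulatorSolvable δ c k := by
  obtain ⟨a, h⟩ := h
  refine ⟨a, h.mono fun x _ => ?_⟩
  gcongr

theorem le_two_of_pos {ε s : ℝ} {a : ℕ} (hs : 0 ≤ s) (h : 0 < a * (2 - ε) ^ 1 * s) : ε ≤ 2 := by
  by_contra hε
  have h1 : (a : ℝ) * (2 - ε) ^ 1 ≤ 0 :=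
    mul_nonpos_of_nonneg_of_nonpos (Nat.cast_nonneg a) (by linarith)
  exact absurd h (not_lt.2 (mul_nonpos_of_nonpos_of_nonneg h1 hs))

theorem vars_singleton : CNF.vars [[(0, true)]] = {0} := rfl

theorem KSatSolvable.le_two {ε : ℝ} (h : KSatSolvable ε 1) : ε ≤ 2 := by
  obtain ⟨a, h⟩ := h
  have := h.pos (x := [[(0, true)]]) (by simp [CNF.IsKCNF])
  rw [vars_singleton, Finset.card_singleton] at this
  exact le_two_of_pos (by positivity) this

theorem hasTreeDepthAtMost_zero {φ : CNF} {M : List ℕ} (hM : ∀ v ∈ φ.vars, v ∈ M) :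
    HasTreeDepthAtMost (φ.primalGraphSub M) 0 :=
  ⟨fun _ => none, fun v => absurd (hM _ v.1.2) v.2, fun u => absurd (hM _ u.1.2) u.2⟩

theorem KSatModulatorSolvable.le_two {ε : ℝ} (h : KSatModulatorSolvable ε 0 1) : ε ≤ 2 := by
  obtain ⟨a, h⟩ := h
  have := h.pos (x := ([[(0, true)]], [0])) ⟨by simp [CNF.IsKCNF], by simp,
    by simp [vars_singleton], hasTreeDepthAtMost_zero (by simp [vars_singleton])⟩
  exact le_two_of_pos (by positivity) this

/-! ### The two reductions and their running times -/

theorem one_le_size (φ : CNF) : 1 ≤ φ.size := by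
  rw [size_eq]
  omega

theorem KSatSolvable.modulator {ε : ℝ} {c k : ℕ} (hε : ε ≤ 1)
    (h : KSatSolvable ε (2 ^ c * k)) : KSatModulatorSolvable ε c k := by
  obtain ⟨a, h⟩ := h
  obtain ⟨P, hP⟩ := Prog.exec_reduceProg c
  -- The summands stand for the reduction, the transfer of its output, and the polynomial factor of
  -- the machine on an instance of size at most `P`.
  obtain ⟨b, hb⟩ := exists_eval_le (P + (P + 1) + (a : Polynomial ℕ) * P ^ a)
  refine ⟨b, SolvableInTime.precompose (Prog.reduceProg c) .inp .out h
    (fun x => (CNF.resolve^[c] x.1).restrict x.2) (fun x => P.eval x.1.size)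
    (fun x hx => (hx.1.iterate_resolve c).restrict x.2)
    (fun x hx => (satisfiable_restrict_iff hx.2.2.2).symm)
    (fun x hx => (hP x.1 x.2 ⟨hx.2.1, hx.2.2.1⟩).2) fun x hx => ?_⟩
  obtain ⟨hsize, -⟩ := hP x.1 x.2 ⟨hx.2.1, hx.2.2.1⟩
  have hbn := hb x.1.size (one_le_size x.1)
  simp only [Polynomial.eval_add, Polynomial.eval_mul, Polynomial.eval_pow, Polynomial.eval_one,
    Polynomial.eval_natCast] at hbn
  set ψ := (CNF.resolve^[c] x.1).restrict x.2
  set p := P.eval x.1.size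
  have hcard : ψ.vars.card ≤ x.2.length :=
    (Finset.card_le_card (CNF.vars_restrict_subset _ _)).trans (List.toFinset_card_le _)
  -- A base of at least 1 is used twice: to raise the exponent from the number of remaining
  -- variables to `|M|`, and to absorb the additive overhead.
  have h1 : (1 : ℝ) ≤ 2 - ε := by linarith
  have hpow : (1 : ℝ) ≤ (2 - ε) ^ x.2.length := one_le_pow₀ h1
  have henc : ((encodeCNF ψ).length : ℝ) ≤ p := by exact_mod_cast hsize
  have hT : (a : ℝ) * (2 - ε) ^ ψ.vars.card * (ψ.size : ℝ) ^ a ≤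
      a * (2 - ε) ^ x.2.length * (p : ℝ) ^ a := by
    gcongr
  calc (p : ℝ) + ((encodeCNF ψ).length + 1) + a * (2 - ε) ^ ψ.vars.card * (ψ.size : ℝ) ^ a
      ≤ (p + (p + 1)) * 1 + a * (2 - ε) ^ x.2.length * (p : ℝ) ^ a := by linarith
    _ ≤ (p + (p + 1)) * (2 - ε) ^ x.2.length + a * (2 - ε) ^ x.2.length * (p : ℝ) ^ a := by
        gcongr
    _ = (2 - ε) ^ x.2.length * ((p + (p + 1) + a * p ^ a : ℕ) : ℝ) := by push_cast; ring
    _ ≤ (2 - ε) ^ x.2.length * ((b * x.1.size ^ b : ℕ) : ℝ) := by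
        gcongr
        exact_mod_cast hbn
    _ = b * (2 - ε) ^ x.2.length * (x.1.size : ℝ) ^ b := by push_cast; ring

theorem KSatModulatorSolvable.kSat {ε : ℝ} {k : ℕ} (hε : ε ≤ 1)
    (h : KSatModulatorSolvable ε 0 k) : KSatSolvable ε k := by
  obtain ⟨a, h⟩ := h
  obtain ⟨b, hb⟩ := exists_eval_le (120 * (Polynomial.X + 1) ^ 4 + (2 * Polynomial.X + 1) +
    (a : Polynomial ℕ) * Polynomial.X ^ a)
  refine ⟨b, SolvableInTime.precompose Prog.varListProg .inp .out h
    (fun φ => (φ, φ.varList)) (fun φ => 120 * (φ.size + 1) ^ 4)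
    (fun φ hφ => ⟨hφ, (isVarList_varList φ).1, (isVarList_varList φ).2,
      hasTreeDepthAtMost_zero fun v hv => mem_varList.2 hv⟩)
    (fun φ _ => Iff.rfl) (fun φ _ => Prog.run_varListProg φ) fun φ _ => ?_⟩
  have hbn := hb φ.size (one_le_size φ)
  simp only [Polynomial.eval_add, Polynomial.eval_mul, Polynomial.eval_pow, Polynomial.eval_one,
    Polynomial.eval_natCast, Polynomial.eval_X, Polynomial.eval_ofNat] at hbn
  -- Formula and end marker take `|φ|` symbols, the list of variables fewer than `|φ|`.
  have henc : (encodeCNFWithSet (φ, φ.varList)).length ≤ 2 * φ.size := by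
    have h1 := length_flatMap_encodeModVar_le (isVarList_varList φ).1 (isVarList_varList φ).2
    have h2 := size_eq φ
    rw [encodeCNFWithSet_eq, List.length_append, List.length_cons]
    omega
  have henc' : ((encodeCNFWithSet (φ, φ.varList)).length : ℝ) ≤ 2 * φ.size := by
    exact_mod_cast henc
  have hpow : (1 : ℝ) ≤ (2 - ε) ^ φ.vars.card := one_le_pow₀ (by linarith)
  rw [length_varList]
  calc ((120 * (φ.size + 1) ^ 4 : ℕ) : ℝ) + ((encodeCNFWithSet (φ, φ.varList)).length + 1) +
        a * (2 - ε) ^ φ.vars.card * (φ.size : ℝ) ^ a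
      ≤ ((120 * (φ.size + 1) ^ 4 : ℕ) + (2 * φ.size + 1)) * 1 +
        a * (2 - ε) ^ φ.vars.card * (φ.size : ℝ) ^ a := by linarith
    _ ≤ ((120 * (φ.size + 1) ^ 4 : ℕ) + (2 * φ.size + 1)) * (2 - ε) ^ φ.vars.card +
        a * (2 - ε) ^ φ.vars.card * (φ.size : ℝ) ^ a := by gcongr
    _ = (2 - ε) ^ φ.vars.card *
        ((120 * (φ.size + 1) ^ 4 + (2 * φ.size + 1) + a * φ.size ^ a : ℕ) : ℝ) := by
        push_cast; ring
    _ ≤ (2 - ε) ^ φ.vars.card * ((b * φ.size ^ b : ℕ) : ℝ) := by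
        gcongr
        exact_mod_cast hbn
    _ = b * (2 - ε) ^ φ.vars.card * (φ.size : ℝ) ^ b := by push_cast; ring

theorem mainTheorem4 :
    ¬ SETH ↔ ∃ ε : ℝ, 0 < ε ∧ ∀ c k : ℕ, KSatModulatorSolvable ε c k := by
  unfold SETH
  push Not
  constructor
  · rintro ⟨ε, hε, h⟩
    -- The instances of arity 1 give `ε ≤ 2`, so `ε` may be decreased to `min ε 1`. This value does
    -- not depend on `c` or `k`.
    refine ⟨min ε 1, by positivity, fun c k => ?_⟩
    exact ((h (2 ^ c * k)).mono (h 1).le_two (min_le_left ε 1)).modulator (min_le_right ε 1)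
  · rintro ⟨ε, hε, h⟩
    refine ⟨min ε 1, by positivity, fun k => ?_⟩
    exact ((h 0 k).mono (h 0 1).le_two (min_le_left ε 1)).kSat (min_le_right ε 1)
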